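/- A prefix Turing machine $M$ has a one-way read-only program tape carrying an infinite sequence of bits, an auxiliary tape, one or more work tapes and an output tape; all tapes are one-way infinite. For binary strings $p,y,x$ write $M^d(p,y)=x$ if, with $y$ on the auxiliary tape and with a program tape that begins with $p$, $M$ halts within $d$ steps with output $x$, the sequence of bits scanned on the program tape being exactly $p$; write $M(p,y)=x$ if this holds for some $d$, and omit $y$ if it is the empty string. Let $U$ be an optimal universal prefix Turing machine: for every prefix Turing machine $T$ there is a constant $c_T$ such that whenever $T(p,y)=x$ there is $q$ with $|q|\le |p|+c_T$ and $U(q,y)=x$. Let $K(x)=\min\{|p|:U(p)=x\}$ be the prefix complexity of $x$. A program $p$ is called $b$-incompressible if $|p|\le K(p)+b$. The logical depth of $x$ at significance level $b$ is $$d_b(x)=\min\{d : U^d(p)=x \text{ for some } p \text{ with } |p|\le K(p)+b\}.$$ Call the level $b$ admissible for $x$ if some shortest program for $x$ (a $p$ with $U(p)=x$ and $|p|=K(x)$) is $b$-incompressible. Let $$f(n)=\max\{\,d_b(x)-d_{b+1}(x) : |x|=n,\ 0\le b\le n,\ b \text{ admissible for } x\,\}$$ (with $f(n)=0$ for the finitely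 many $n$, if any, for which there is no such pair $(x,b)$). Let $BB(n)$ be the Busy Beaver function, the maximal number of $1$'s left on the tape by an $n$-state two-symbol Turing machine that halts when started on a blank tape. Theorem. (i) There is a constant $c$, depending only on $U$, such that every $b\ge c$ is admissible for every $x$. (ii) The function $f$ grows faster than any computable function: for every computable $g:\mathbb N\to\mathbb N$ one has $f(n)>g(n)$ for all but finitely many $n$. (iii) The function $f$ does not grow as fast as the Busy Beaver function: $f(n)/BB(n)\to 0$ as $n\to\infty$. -/

import Mathlib

open Filter Asymptotics

/-! ### Prefix Turing machines -/

/-- Head moves on a two-way tape. -/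
inductive HeadMove where
  | left
  | stay
  | right

/-- A linear one-way infinite tape: cells `0, 1, 2, …` and the position of the scanning head. -/
structure OneWayTape (Γ : Type) where
  cell : ℕ → Γ
  head : ℕ

namespace OneWayTape

variable {Γ : Type}

/-- The symbol under scan. -/
def scanned (τ : OneWayTape Γ) : Γ := τ.cell τ.head

/-- Write the symbol `a` in the scanned cell and then move the head (a head scanning the leftmost
cell stays there when told to move left). -/
def act (τ : OneWayTape Γ) (a : Γ) (m : HeadMove) : OneWayTape Γ where
  cell := Function.update τ.cell τ.head a
  head := match m with
    | .left => τ.head - 1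
    | .stay => τ.head
    | .right => τ.head + 1

end OneWayTape

/-- The names of the tapes of a machine other than its program tape: the auxiliary tape, the output
tape, and the work tapes, which are indexed by `W`. -/
inductive TapeName (W : Type) where
  | aux
  | out
  | work (w : W)

/-- What a machine does in one step: enter a state, move the program head one cell to the right or
leave it where it is, and on each other tape write a symbol and move the head. -/
structure MachineAction (Q Γ W : Type) where
  next : Q
  advance : Bool
  write : TapeName W → Γ
  move : TapeName W → HeadMove

/-- A prefix Turing machine: a finite control with state set `Q`, a one-way read-only program tape
holding bits, and an auxiliary tape, an output tape and one or more work tapes, with symbols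
from the finite set `Γ`. The machine halts when the transition function prescribes no action. -/
structure PrefixTM where
  Q : Type
  Γ : Type
  W : Type
  finite_Q : Finite Q
  finite_Γ : Finite Γ
  finite_W : Finite W
  nonempty_W : Nonempty W
  start : Q
  blank : Γ
  bit : Bool → Γ
  bit_injective : Function.Injective bit
  bit_ne_blank : ∀ b, bit b ≠ blank
  δ : Q → Bool → (TapeName W → Γ) → Option (MachineAction Q Γ W)

namespace PrefixTM

/-- A configuration (without the contents of the program tape, which never change). -/
structure Cfg (M : PrefixTM) where
  state : M.Q
  progHead : ℕ
  tape : TapeName M.W → OneWayTape M.Γ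

/-- One step with contents `ω` of the program tape; `none` if the machine halts. -/
def step (M : PrefixTM) (ω : ℕ → Bool) (c : M.Cfg) : Option M.Cfg :=
  (M.δ c.state (ω c.progHead) (fun i => (c.tape i).scanned)).map fun a =>
    { state := a.next
      progHead := if a.advance then c.progHead + 1 else c.progHead
      tape := fun i => (c.tape i).act (a.write i) (a.move i) }

/-- The blank tape with the string `y` written on it, scanned at its leftmost cell. -/
def inputTape (M : PrefixTM) (y : List Bool) : OneWayTape M.Γ where
  cell := fun i => (y[i]?).elim M.blank M.bit
  head := 0

/-- The initial configuration with auxiliary string `y`. -/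
def init (M : PrefixTM) (y : List Bool) : M.Cfg where
  state := M.start
  progHead := 0
  tape := fun i => match i with
    | .aux => M.inputTape y
    | .out => M.inputTape []
    | .work _ => M.inputTape []

/-- The configuration after exactly `t` steps, `none` if the machine has halted earlier. -/
def cfgAfter (M : PrefixTM) (ω : ℕ → Bool) (y : List Bool) (t : ℕ) : Option M.Cfg :=
  (fun o : Option M.Cfg => o.bind (M.step ω))^[t] (some (M.init y))

/-- The string on the output tape: the maximal binary string that starts in the leftmost cell. -/
def Cfg.HasOutput {M : PrefixTM} (c : M.Cfg) (x : List Bool) : Prop :=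
  (∀ (i : ℕ) (h : i < x.length), (c.tape .out).cell i = M.bit x[i]) ∧
    ∀ b, (c.tape .out).cell x.length ≠ M.bit b

/-- `M^d(p, y) = x`: with auxiliary string `y`, and a program tape that begins with `p`, the machine
halts within `d` steps with output `x`, and the sequence of bits scanned on the program tape is
exactly `p`. (The padding of the program tape beyond `p` is immaterial: those cells are not
scanned.) -/
def OutputsWithin (M : PrefixTM) (d : ℕ) (p y x : List Bool) : Prop :=
  ∃ t ≤ d, ∃ c : M.Cfg, M.cfgAfter (fun i => p.getD i false) y t = some c ∧
    M.step (fun i => p.getD i false) c = none ∧ c.progHead + 1 = p.length ∧ c.HasOutput x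

/-- `M(p, y) = x`. -/
def Outputs (M : PrefixTM) (p y x : List Bool) : Prop :=
  ∃ d, M.OutputsWithin d p y x

/-- `U` is an optimal universal prefix machine: it simulates every prefix machine `T`, at the cost
of lengthening programs by at most a constant that depends on `T` alone. -/
def IsOptimalUniversal (U : PrefixTM) : Prop :=
  ∀ T : PrefixTM, ∃ c : ℕ, ∀ p y x, T.Outputs p y x →
    ∃ q, q.length ≤ p.length + c ∧ U.Outputs q y x

/-! ### Kolmogorov complexity and logical depth -/

/-- The prefix Kolmogorov complexity `K(x | y)` with respect to `U`. -/
noncomputable def condK (U : PrefixTM) (x y : List Bool) : ℕ :=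
  sInf {l | ∃ p : List Bool, U.Outputs p y x ∧ p.length = l}

/-- The prefix Kolmogorov complexity `K(x) = K(x | ε)` with respect to `U`. -/
noncomputable def K (U : PrefixTM) (x : List Bool) : ℕ := U.condK x []

/-- `p` is a shortest program for `x`. -/
def IsShortestProgram (U : PrefixTM) (p x : List Bool) : Prop :=
  U.Outputs p [] x ∧ p.length = U.K x

/-- The string `p` is `b`-incompressible as a program. -/
def IsIncompressibleProgram (U : PrefixTM) (b : ℕ) (p : List Bool) : Prop :=
  p.length ≤ U.K p + b

/-- The logical depth of `x` at significance level `b`: the least number of steps to compute `x`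
by a `b`-incompressible program. -/
noncomputable def logicalDepth (U : PrefixTM) (b : ℕ) (x : List Bool) : ℕ :=
  sInf {d | ∃ p : List Bool, U.OutputsWithin d p [] x ∧ U.IsIncompressibleProgram b p}

/-- The significance level `b` is admissible for `x`: some shortest program for `x` is
`b`-incompressible. -/
def Admissible (U : PrefixTM) (b : ℕ) (x : List Bool) : Prop :=
  ∃ p, U.IsShortestProgram p x ∧ U.IsIncompressibleProgram b p

theorem Admissible.mono {U : PrefixTM} {b b' : ℕ} {x : List Bool} (h : U.Admissible b x)
    (hb : b ≤ b') : U.Admissible b' x := by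
  obtain ⟨p, hp, hi⟩ := h
  exact ⟨p, hp, le_trans hi (Nat.add_le_add_left hb _)⟩

/-- At an admissible level the set whose least element is the logical depth is nonempty. -/
theorem Admissible.exists_time {U : PrefixTM} {b : ℕ} {x : List Bool} (h : U.Admissible b x) :
    {d | ∃ p : List Bool, U.OutputsWithin d p [] x ∧ U.IsIncompressibleProgram b p}.Nonempty := by
  obtain ⟨p, ⟨⟨d, hd⟩, -⟩, hi⟩ := h
  exact ⟨d, p, hd, hi⟩

/-- The depth does not increase with the level, so that the differences below are not
truncated. -/
theorem Admissible.logicalDepth_succ_le {U : PrefixTM} {b : ℕ} {x : List Bool}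
    (h : U.Admissible b x) : U.logicalDepth (b + 1) x ≤ U.logicalDepth b x := by
  obtain ⟨p, hd, hi⟩ := Nat.sInf_mem h.exists_time
  exact Nat.sInf_le ⟨p, hd, le_trans hi (Nat.add_le_add_left (Nat.le_succ b) _)⟩

/-- The drops in logical depth of the strings of length `n`, at the admissible levels `b ≤ n`. -/
def depthDrops (U : PrefixTM) (n : ℕ) : Set ℕ :=
  {k | ∃ (x : List Bool) (b : ℕ), x.length = n ∧ b ≤ n ∧ U.Admissible b x ∧
    k = U.logicalDepth b x - U.logicalDepth (b + 1) x}

theorem finite_depthDrops (U : PrefixTM) (n : ℕ) : (U.depthDrops n).Finite := by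
  have h1 : {x : List Bool | x.length = n}.Finite := List.finite_length_eq Bool n
  refine ((h1.prod (Set.finite_Iic n)).image
    fun z => U.logicalDepth z.2 z.1 - U.logicalDepth (z.2 + 1) z.1).subset ?_
  rintro k ⟨x, b, hx, hb, -, rfl⟩
  exact ⟨(x, b), ⟨hx, hb⟩, rfl⟩

/-- The maximal drop in logical depth over the strings of length `n` and the levels `b ≤ n`. -/
noncomputable def maxDepthDrop (U : PrefixTM) (n : ℕ) : ℕ := sSup (U.depthDrops n)

end PrefixTM

/-! ### The Busy Beaver function -/

/-- An `n`-state two-symbol Turing machine of the Busy Beaver game: for each state and scanned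
symbol, the symbol to write, the direction to move, and the next state, `none` being the halting
state (which does not count). -/
def BeaverMachine (n : ℕ) : Type := Fin n → Bool → Bool × Turing.Dir × Option (Fin n)

namespace BeaverMachine

variable {n : ℕ}

/-- One step on a two-way infinite tape. -/
def step (M : BeaverMachine n) :
    Option (Fin n) × Turing.Tape Bool → Option (Option (Fin n) × Turing.Tape Bool)
  | (none, _) => none
  | (some q, T) =>
    let a := M q T.head
    some (a.2.2, (T.write a.1).move a.2.1)

/-- The initial configuration: the first state on the blank (all `false`) tape. -/
def init (n : ℕ) : Option (Fin n) × Turing.Tape Bool :=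
  (if h : 0 < n then some ⟨0, h⟩ else none, default)

/-- Started on the blank tape, `M` reaches the halting state with tape `T`. -/
def HaltsWith (M : BeaverMachine n) (T : Turing.Tape Bool) : Prop :=
  ∃ t : ℕ, (fun o => Option.bind o M.step)^[t] (some (init n)) = some (none, T)

end BeaverMachine

/-- The numbers of `1`s left on the tape by the halting `n`-state machines. -/
def beaverScores (n : ℕ) : Set ℕ :=
  {k | ∃ (M : BeaverMachine n) (T : Turing.Tape Bool), M.HaltsWith T ∧
    k = {i : ℤ | T.nth i = true}.ncard}

theorem BeaverMachine.HaltsWith.unique {n : ℕ} {M : BeaverMachine n} {T T' : Turing.Tape Bool}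
    (h : M.HaltsWith T) (h' : M.HaltsWith T') : T = T' := by
  have key : ∀ (t s : ℕ) (S S' : Turing.Tape Bool),
      (fun o => Option.bind o M.step)^[t] (some (BeaverMachine.init n)) = some (none, S) →
      (fun o => Option.bind o M.step)^[t + s] (some (BeaverMachine.init n)) = some (none, S') → S = S' := by
    intro t s S S' h1 h2
    cases s with
    | zero => simp_all
    | succ s =>
      have h3 : ∀ k : ℕ, (fun o => Option.bind o M.step)^[k] none = none := fun k =>
        Function.iterate_fixed rfl k
      rw [show t + (s + 1) = s + 1 + t by omega, Function.iterate_add_apply, h1,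
        Function.iterate_succ_apply] at h2
      rw [show Option.bind (some ((none : Option (Fin n)), S)) M.step = none from rfl, h3] at h2
      cases h2
  obtain ⟨t, ht⟩ := h
  obtain ⟨t', ht'⟩ := h'
  rcases le_total t t' with hle | hle
  · obtain ⟨s, rfl⟩ := Nat.exists_eq_add_of_le hle
    exact key t s T T' ht ht'
  · obtain ⟨s, rfl⟩ := Nat.exists_eq_add_of_le hle
    exact (key t' s T' T ht' ht).symm

theorem finite_beaverScores (n : ℕ) : (beaverScores n).Finite := by
  have : Finite Turing.Dir :=
    Finite.of_injective (fun d : Turing.Dir => decide (d = Turing.Dir.left)) (by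
      intro a b; cases a <;> cases b <;> simp)
  have : Finite (BeaverMachine n) :=
    inferInstanceAs (Finite (Fin n → Bool → Bool × Turing.Dir × Option (Fin n)))
  refine (Set.finite_iUnion (f := fun M : BeaverMachine n =>
    (fun T : Turing.Tape Bool => {i : ℤ | T.nth i = true}.ncard) '' {T | M.HaltsWith T})
    fun M => Set.Finite.image _ (Set.Subsingleton.finite ?_)).subset ?_
  · intro T hT T' hT'
    exact BeaverMachine.HaltsWith.unique hT hT'
  · rintro k ⟨M, T, hT, rfl⟩
    exact Set.mem_iUnion.2 ⟨M, T, hT, rfl⟩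

/-- The Busy Beaver function: the maximal number of `1`s left on the tape by an `n`-state two-symbol
Turing machine that halts when started on the blank tape. -/
noncomputable def busyBeaver (n : ℕ) : ℕ := sSup (beaverScores n)

/-! ### Prefix machines computing partial recursive functions -/

namespace StackMachine

open Turing Turing.PartrecToTM2 StateTransition

/-! (i) A program q for a program p of x can be executed in two stages, so it gives a program for x
that is longer by a constant only (`exists_program_of_program`). If p is a shortest program for x,
then |p| = K(x) ≤ K(p) + c, that is, p is c-incompressible.

(ii) Let G be a computable time bound. Consider the 2^(n/4) strings that consist of zeros followed
by a string z of length n/4. Each program tape of length G + 2 yields at most one output within G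
steps, so by pigeonhole some x of this form is produced by at most the fraction 2^(-n/4) of these
tapes, and such an x can be computed from n. A program p that outputs x within G steps occupies the
fraction 2^(-|p|) of all tapes, hence a fraction of at least 2^(n/4-|p|) of the tapes that yield x.
An interval code in the style of Shannon and Fano (`exists_decodeInterval`) therefore describes p by
about |p| - n/4 bits, and n itself costs about n/16 bits (`header`). So all fast programs for x are
compressible by about 3n/16, and the depth of x at a constant level c₁ exceeds G(n) (`exists_rare`).
At level n + 1, however, every program of length at most n + 1 counts as incompressible; x has one
of length about 5n/16, and an exhaustive search bounds its running time by a computable R(n)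
(`exists_computable_time`). With G = R + (n + 1)g + n the depth loses more than (n + 1)g(n) between
the levels c₁ and n + 1, so a single level accounts for more than g(n).

(iii) A drop is at most the depth, which at an admissible level is at most the halting time t of
some shortest program p for x, and |p| ≤ 17n/16 + O(1). A two-symbol machine with n states can carry
two bits of data per state, apart from a constant number C of states, so it can hold p, determine t,
and leave at least t(n - C) ones (`exists_time_mul_le_busyBeaver`). Hence f(n)(n - C) ≤ BB(n).

Most of the work connects the models of computation: partial recursive functions become prefix
machines (`machine_outputs`), prefix machines are simulated primitive recursively (`Sim.simulator`),
and a code together with a long input becomes a Busy Beaver machine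
(`exists_length_trNat_le_busyBeaver`). For the last point the number of data already written is kept
in unary on the tape. A chain of states counts it, and the state reached at its end holds the next
datum in its transition. -/

noncomputable instance {W : Type} : DecidableEq (TapeName W) := Classical.decEq _

/-- Tape symbols: blank, or a symbol of the stack alphabet. -/
abbrev Sym := Option Γ'

/-- Statements of the stack machines running codes. -/
abbrev Stm := TM2.Stmt (fun _ : K' => Γ') Λ' (Option Γ')

/-- Configurations of the stack machines running codes. -/
abbrev Cf := TM2.Cfg (fun _ : K' => Γ') Λ' (Option Γ')

/-- The program of the stack machines running codes. -/
abbrev prog : Λ' → Stm := tr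

/-- The stack symbol representing a bit. -/
def bitSym (b : Bool) : Γ' := if b then Γ'.bit1 else Γ'.bit0

/-- A one-way tape represents a stack: cell `0` is blank, the stack is stored from the bottom up in
the cells `1, 2, …`, and the head scans the top. -/
structure Rep (τ : OneWayTape Sym) (l : List Γ') : Prop where
  head : τ.head = l.length
  zero : τ.cell 0 = none
  cell : ∀ i a, l.reverse[i]? = some a → τ.cell (i + 1) = some a

theorem Rep.scanned {τ : OneWayTape Sym} {l : List Γ'} (h : Rep τ l) : τ.scanned = l.head? := by
  cases l with
  | nil => simpa [OneWayTape.scanned, h.head] using h.zero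
  | cons a l =>
    have := h.cell l.length a (by simp)
    simpa [OneWayTape.scanned, h.head] using this

theorem Rep.pop {τ : OneWayTape Sym} {l : List Γ'} (h : Rep τ l) :
    Rep (τ.act none HeadMove.left) l.tail := by
  refine ⟨by simp [OneWayTape.act, h.head], ?_, ?_⟩
  · simp only [OneWayTape.act, Function.update_apply, h.zero, ite_self]
  · intro i a ha
    cases l with
    | nil => simp at ha
    | cons b l =>
      simp only [List.tail_cons] at ha
      have hi : i < l.length := by
        by_contra hc
        rw [List.getElem?_eq_none (by simpa using hc)] at ha
        cases ha
      simp only [OneWayTape.act, h.head, List.length_cons]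
      rw [Function.update_of_ne (by omega)]
      apply h.cell
      rw [List.reverse_cons, List.getElem?_append_left (by simpa using hi), ha]

/-- A machine writes before it moves, whereas a push must move before it writes. So it takes two
actions, the first of which rewrites the scanned symbol unchanged. -/
theorem Rep.push {τ : OneWayTape Sym} {l : List Γ'} (h : Rep τ l) (a : Γ') :
    Rep ((τ.act τ.scanned HeadMove.right).act (some a) HeadMove.stay) (a :: l) := by
  refine ⟨by simp [OneWayTape.act, h.head], ?_, ?_⟩
  · simp [OneWayTape.act, OneWayTape.scanned, h.zero]
  · intro i b hb
    simp only [OneWayTape.act, OneWayTape.scanned, Function.update_eq_self, h.head]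
    rw [List.reverse_cons] at hb
    rcases lt_or_ge i l.length with hi | hi
    · rw [Function.update_of_ne (by omega)]
      apply h.cell
      rwa [List.getElem?_append_left (by simpa using hi)] at hb
    · rw [List.getElem?_append_right (by simpa using hi)] at hb
      have : i = l.length := by
        by_contra hc
        rw [List.getElem?_eq_none (by simp; omega)] at hb
        cases hb
      subst this
      simpa using hb

theorem act_scanned_stay {Γ : Type} (τ : OneWayTape Γ) : τ.act τ.scanned HeadMove.stay = τ := by
  simp [OneWayTape.act, OneWayTape.scanned]

/-- The control states of the machine running a code on the stacks. -/
inductive Ctl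
  | start
  | start'
  | read
  | run (q : Stm) (v : Option Γ')
  | fin
  | hold
  | emit (g : Γ')

/-- A control state, possibly with a symbol still to be pushed. -/
abbrev St := Option (K' × Γ') × Ctl

/-- An action on a single tape: next state, whether to advance the program head, the tape, the
symbol to write and the head move. -/
abbrev Act := St × Bool × TapeName K' × Sym × HeadMove

/-- Push a symbol (first half: move the head up). -/
def pushAct (k : K') (a : Γ') (s : Ctl) (sc : TapeName K' → Sym) : Act :=
  ((some (k, a), s), false, .work k, sc (.work k), .right)

/-- Change the control state only. -/
def idleAct (s : Ctl) (sc : TapeName K' → Sym) : Act :=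
  ((none, s), false, .out, sc .out, .stay)

/-- Pop a symbol. -/
def popAct (k : K') (s : Ctl) (adv : Bool) : Act :=
  ((none, s), adv, .work k, none, .left)

/-- The transition function of the machine for the code `c`: it keeps a number `N` on the main
stack, repeatedly reads a program bit `b`, and runs `c` on `2 * N + b`. An even result `2 * N'` makes
it continue with `N'`, an odd result is written on the output tape. -/
def trans (c : ToPartrec.Code) : St → Bool → (TapeName K' → Sym) → Option Act
  | (some (k, a), s), _, _ => some ((none, s), false, .work k, some a, .stay)
  | (none, .start), _, sc => some (pushAct .main .cons .start' sc)
  | (none, .start'), _, sc => some (pushAct .main .bit1 .read sc)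
  | (none, .read), b, sc =>
    some (pushAct .main (bitSym b) (.run (prog (trNormal c Cont'.halt)) none) sc)
  | (none, .run (.push k f q) v), _, sc => some (pushAct k (f v) (.run q v) sc)
  | (none, .run (.peek k f q) v), _, sc => some (idleAct (.run q (f v (sc (.work k)))) sc)
  | (none, .run (.pop k f q) v), _, sc => some (popAct k (.run q (f v (sc (.work k)))) false)
  | (none, .run (.load a q) v), _, sc => some (idleAct (.run q (a v)) sc)
  | (none, .run (.branch p q₁ q₂) v), _, sc => some (idleAct (.run (cond (p v) q₁ q₂) v) sc)
  | (none, .run (.goto l) v), _, sc => some (idleAct (.run (prog (l v)) v) sc)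
  | (none, .run .halt _), _, sc => some (idleAct .fin sc)
  | (none, .fin), _, sc =>
    if sc (.work .main) = some .bit0 then some (popAct .main .read true)
    else some (popAct .main .hold false)
  | (none, .hold), _, sc => some (popAct .main (.emit ((sc (.work .main)).getD .bit0)) false)
  | (none, .emit g), _, sc =>
    if sc (.work .main) = some .cons then none
    else some ((none, .hold), false, .out, some g, .right)

/-- The finite set of control states used by the machine for `c`. -/
def ctlSupp (c : ToPartrec.Code) : Set Ctl :=
  {.start, .start', .read, .fin, .hold} ∪ Set.range Ctl.emit ∪
    {s | ∃ q v, s = .run q v ∧ some q ∈ TM2.stmts prog (codeSupp c Cont'.halt)}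

instance : Finite K' := Finite.of_surjective
  (fun i : Fin 4 => match i with | 0 => K'.main | 1 => K'.rev | 2 => K'.aux | 3 => K'.stack) (by
    rintro (_ | _ | _ | _)
    exacts [⟨0, rfl⟩, ⟨1, rfl⟩, ⟨2, rfl⟩, ⟨3, rfl⟩])

theorem finite_ctlSupp (c : ToPartrec.Code) : (ctlSupp c).Finite := by
  refine ((Set.toFinite _).union (Set.finite_range _)).union ?_
  have h := Finset.finite_toSet (TM2.stmts prog (codeSupp c Cont'.halt))
  refine ((h.prod (Set.finite_univ (α := Option Γ'))).image
    (fun z => Ctl.run (z.1.getD TM2.Stmt.halt) z.2)).subset ?_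
  rintro s ⟨q, v, rfl, hq⟩
  exact ⟨(some q, v), ⟨hq, trivial⟩, rfl⟩

theorem run_mem_ctlSupp {c : ToPartrec.Code} {q : Stm} {v : Option Γ'} :
    Ctl.run q v ∈ ctlSupp c ↔ some q ∈ TM2.stmts prog (codeSupp c Cont'.halt) := by
  simp [ctlSupp]

theorem tr_mem_stmts {c : ToPartrec.Code} {l : Λ'} (h : l ∈ codeSupp c Cont'.halt) :
    some (prog l) ∈ TM2.stmts prog (codeSupp c Cont'.halt) := by
  classical exact Finset.some_mem_insertNone.2 (Finset.mem_biUnion.2 ⟨l, h, TM2.stmts₁_self⟩)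

theorem trNormal_mem (c : ToPartrec.Code) :
    some (prog (trNormal c Cont'.halt)) ∈ TM2.stmts prog (codeSupp c Cont'.halt) :=
  tr_mem_stmts (codeSupp_self _ _ (trStmts₁_self _))

/-- The type of all control states is infinite, since it contains all statements. Closure under
transitions allows the machine to be restricted to the finite set `ctlSupp c`. -/
theorem trans_closed {c : ToPartrec.Code} {s : St} (hs : s.2 ∈ ctlSupp c) {b : Bool}
    {sc : TapeName K' → Sym} {a : Act} (ha : trans c s b sc = some a) : a.1.2 ∈ ctlSupp c := by
  obtain ⟨p, s⟩ := s
  rcases p with _ | ⟨k, g⟩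
  · cases s with
    | start => cases ha; simp [pushAct, ctlSupp]
    | start' => cases ha; simp [pushAct, ctlSupp]
    | read => cases ha; exact run_mem_ctlSupp.2 (trNormal_mem c)
    | fin => simp only [trans] at ha; split_ifs at ha <;> cases ha <;> simp [popAct, ctlSupp]
    | hold => cases ha; simp [popAct, ctlSupp]
    | emit g =>
      simp only [trans] at ha
      split_ifs at ha
      cases ha; simp [ctlSupp]
    | run q v =>
      have hq := run_mem_ctlSupp.1 hs
      cases q with
      | push k f q =>
        cases ha
        exact run_mem_ctlSupp.2 (TM2.stmts_trans (by unfold TM2.stmts₁; simp [TM2.stmts₁_self]) hq)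
      | peek k f q =>
        cases ha
        exact run_mem_ctlSupp.2 (TM2.stmts_trans (by unfold TM2.stmts₁; simp [TM2.stmts₁_self]) hq)
      | pop k f q =>
        cases ha
        exact run_mem_ctlSupp.2 (TM2.stmts_trans (by unfold TM2.stmts₁; simp [TM2.stmts₁_self]) hq)
      | load f q =>
        cases ha
        exact run_mem_ctlSupp.2 (TM2.stmts_trans (by unfold TM2.stmts₁; simp [TM2.stmts₁_self]) hq)
      | branch f q₁ q₂ =>
        cases ha
        refine run_mem_ctlSupp.2 (TM2.stmts_trans ?_ hq)
        unfold TM2.stmts₁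
        cases f v <;> simp [TM2.stmts₁_self]
      | goto l =>
        cases ha
        have : TM2.SupportsStmt _ _ :=
          @TM2.stmts_supportsStmt _ _ _ _ ⟨trNormal c Cont'.halt⟩ _ _ _
            (PartrecToTM2.tr_supports c Cont'.halt) hq
        exact run_mem_ctlSupp.2 (tr_mem_stmts (this v))
      | halt => cases ha; simp [idleAct, ctlSupp]
  · cases ha; exact hs

/-- The prefix machine for the code `c`. -/
noncomputable def machine (c : ToPartrec.Code) : PrefixTM where
  Q := {s : St // s.2 ∈ ctlSupp c}
  Γ := Sym
  W := K'
  finite_Q := by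
    have : Finite (ctlSupp c) := finite_ctlSupp c
    exact Finite.of_injective (β := Option (K' × Γ') × ctlSupp c)
      (fun s => (s.1.1, ⟨s.1.2, s.2⟩)) (by
        rintro ⟨⟨a, b⟩, h⟩ ⟨⟨a', b'⟩, h'⟩ e
        simp only [Prod.mk.injEq, Subtype.mk.injEq] at e
        simp [e.1, e.2])
  finite_Γ := inferInstance
  finite_W := inferInstance
  nonempty_W := ⟨.main⟩
  start := ⟨(none, .start), by simp [ctlSupp]⟩
  blank := none
  bit b := some (bitSym b)
  bit_injective := by decide
  bit_ne_blank := by simp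
  δ s b sc := (trans c s.1 b sc).pmap
    (fun a h => ⟨⟨a.1, h⟩, a.2.1, Function.update sc a.2.2.1 a.2.2.2.1,
      Function.update (fun _ => HeadMove.stay) a.2.2.1 a.2.2.2.2⟩)
    (fun _ ha => trans_closed s.2 ha)

/-- Configurations with an unrestricted state set. -/
structure RawCfg where
  state : St
  progHead : ℕ
  tape : TapeName K' → OneWayTape Sym

/-- Steps of unrestricted configurations. -/
noncomputable def rawStep (c : ToPartrec.Code) (ω : ℕ → Bool) (C : RawCfg) : Option RawCfg :=
  (trans c C.state (ω C.progHead) fun i => (C.tape i).scanned).map fun a =>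
    { state := a.1
      progHead := if a.2.1 then C.progHead + 1 else C.progHead
      tape := Function.update C.tape a.2.2.1 ((C.tape a.2.2.1).act a.2.2.2.1 a.2.2.2.2) }

/-- Forget that the state lies in the finite set. -/
def toRaw {c : ToPartrec.Code} (C : (machine c).Cfg) : RawCfg := ⟨C.state.1, C.progHead, C.tape⟩

theorem update_act (T : TapeName K' → OneWayTape Sym) (i : TapeName K') (a : Sym) (m : HeadMove) :
    Function.update T i ((T i).act a m) = fun j =>
      (T j).act (Function.update (fun j => (T j).scanned) i a j)
        (Function.update (fun _ => HeadMove.stay) i m j) := by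
  funext j
  by_cases hj : j = i
  · subst hj; simp
  · simp only [Function.update_of_ne hj]
    exact (act_scanned_stay _).symm

/-- The prescribed action is generalized to an arbitrary `o`, so that a case split is possible
despite the membership proofs carried by `pmap`. -/
theorem map_toRaw_pmap {c : ToPartrec.Code} (h : ℕ) (T : TapeName K' → OneWayTape Sym)
    (o : Option Act) (ho : ∀ a, o = some a → a.1.2 ∈ ctlSupp c) :
    (o.map fun a => RawCfg.mk a.1 (if a.2.1 then h + 1 else h)
      (Function.update T a.2.2.1 ((T a.2.2.1).act a.2.2.2.1 a.2.2.2.2))) =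
    Option.map toRaw (Option.map
      (fun a : MachineAction (machine c).Q (machine c).Γ (machine c).W =>
        (⟨a.next, if a.advance then h + 1 else h, fun i => (T i).act (a.write i) (a.move i)⟩ :
          (machine c).Cfg))
      (o.pmap (fun a h => ⟨⟨a.1, h⟩, a.2.1,
        Function.update (fun i => (T i).scanned) a.2.2.1 a.2.2.2.1,
        Function.update (fun _ => HeadMove.stay) a.2.2.1 a.2.2.2.2⟩) ho)) := by
  cases o with
  | none => rfl
  | some a =>
    exact congrArg (fun T' => some (RawCfg.mk a.1 (if a.2.1 then h + 1 else h) T'))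
      (update_act T _ _ _)

theorem rawStep_toRaw {c : ToPartrec.Code} (ω : ℕ → Bool) (C : (machine c).Cfg) :
    rawStep c ω (toRaw C) = ((machine c).step ω C).map toRaw :=
  map_toRaw_pmap _ _ _ _

theorem reaches_of_raw {c : ToPartrec.Code} {ω : ℕ → Bool} {C : (machine c).Cfg} {D : RawCfg}
    (h : Reaches (rawStep c ω) (toRaw C) D) :
    ∃ C', toRaw C' = D ∧ Reaches ((machine c).step ω) C C' := by
  induction h with
  | refl => exact ⟨C, rfl, .refl⟩
  | tail _ h ih =>
    obtain ⟨C', rfl, h'⟩ := ih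
    rw [rawStep_toRaw, Option.mem_def, Option.map_eq_some_iff] at h
    obtain ⟨C'', h1, h2⟩ := h
    exact ⟨C'', h2, h'.tail h1⟩

theorem exists_cfgAfter {M : PrefixTM} {ω : ℕ → Bool} {y : List Bool} {C : M.Cfg}
    (h : Reaches (M.step ω) (M.init y) C) : ∃ t, M.cfgAfter ω y t = some C := by
  induction h with
  | refl => exact ⟨0, rfl⟩
  | tail _ h ih =>
    obtain ⟨t, ht⟩ := ih
    refine ⟨t + 1, ?_⟩
    rw [PrefixTM.cfgAfter, Function.iterate_succ_apply']
    rw [PrefixTM.cfgAfter] at ht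
    rw [ht]
    exact h

/-- The work tapes represent the stacks. -/
def Match (T : TapeName K' → OneWayTape Sym) (S : K' → List Γ') : Prop :=
  ∀ k, Rep (T (.work k)) (S k)

/-! ### Stack operations carried out on one-way tapes -/

section Steps

variable {c : ToPartrec.Code} {ω : ℕ → Bool} {h : ℕ} {T : TapeName K' → OneWayTape Sym}
  {S : K' → List Γ'}

theorem reaches_push {s s' : Ctl} {k : K'} {a : Γ'} (hT : Match T S)
    (hs : trans c (none, s) (ω h) (fun i => (T i).scanned) =
      some (pushAct k a s' fun i => (T i).scanned)) :
    ∃ T', Match T' (Function.update S k (a :: S k)) ∧ T' .out = T .out ∧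
      Reaches (rawStep c ω) ⟨(none, s), h, T⟩ ⟨(none, s'), h, T'⟩ := by
  refine ⟨Function.update T (.work k)
    (((T (.work k)).act (T (.work k)).scanned .right).act (some a) .stay), ?_, by simp, ?_⟩
  · intro k'
    by_cases hk : k' = k
    · subst hk; simpa using (hT k').push a
    · rw [Function.update_of_ne (by simpa using hk), Function.update_of_ne hk]
      exact hT k'
  · refine .head (b := ⟨(some (k, a), s'), h, Function.update T (.work k)
      ((T (.work k)).act (T (.work k)).scanned .right)⟩) ?_ (.single ?_)
    · simp only [rawStep, hs]; rfl
    · simp [rawStep, trans]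

theorem reaches_pop {s s' : Ctl} {k : K'} {adv : Bool} (hT : Match T S)
    (hs : trans c (none, s) (ω h) (fun i => (T i).scanned) = some (popAct k s' adv)) :
    ∃ T', Match T' (Function.update S k (S k).tail) ∧ T' .out = T .out ∧
      Reaches (rawStep c ω) ⟨(none, s), h, T⟩
        ⟨(none, s'), if adv then h + 1 else h, T'⟩ := by
  refine ⟨Function.update T (.work k) ((T (.work k)).act none .left), ?_, by simp, .single ?_⟩
  · intro k'
    by_cases hk : k' = k
    · subst hk; simpa using (hT k').pop
    · rw [Function.update_of_ne (by simpa using hk), Function.update_of_ne hk]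
      exact hT k'
  · simp only [rawStep, hs]; rfl

theorem reaches_idle {s s' : Ctl}
    (hs : trans c (none, s) (ω h) (fun i => (T i).scanned) =
      some (idleAct s' fun i => (T i).scanned)) :
    Reaches (rawStep c ω) ⟨(none, s), h, T⟩ ⟨(none, s'), h, T⟩ := by
  refine .single ?_
  simp only [rawStep, hs, idleAct, Option.map_some, act_scanned_stay, Function.update_eq_self]
  rfl

/-- The control state in which the label `l` is executed. -/
def labelCtl (l : Option Λ') (v : Option Γ') : Ctl := l.elim .fin fun l => .run (prog l) v

/-- Besides the stacks, the induction records that output tape and program head are untouched. This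
is what lets the rounds between two program bits be chained. -/
theorem reaches_stepAux (q : Stm) (v : Option Γ') (hT : Match T S) :
    ∃ T', Match T' (TM2.stepAux q v S).stk ∧ T' .out = T .out ∧
      Reaches (rawStep c ω) ⟨(none, .run q v), h, T⟩
        ⟨(none, labelCtl (TM2.stepAux q v S).l (TM2.stepAux q v S).var), h, T'⟩ := by
  induction q generalizing v T S with
  | push k f q ih =>
    obtain ⟨T₁, h1, h2, h3⟩ := reaches_push (c := c) (ω := ω) (h := h) (s := .run (.push k f q) v)
      (s' := .run q v) (k := k) (a := f v) hT rfl
    obtain ⟨T₂, h1', h2', h3'⟩ := ih v h1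
    exact ⟨T₂, h1', h2'.trans h2, h3.trans h3'⟩
  | peek k f q ih =>
    have h0 := reaches_idle (c := c) (ω := ω) (h := h) (T := T) (s := .run (.peek k f q) v) rfl
    beta_reduce at h0
    rw [(hT k).scanned] at h0
    obtain ⟨T₂, h1', h2', h3'⟩ := ih (f v (S k).head?) hT
    exact ⟨T₂, h1', h2', h0.trans h3'⟩
  | pop k f q ih =>
    obtain ⟨T₁, h1, h2, h3⟩ := reaches_pop (c := c) (ω := ω) (h := h) (s := .run (.pop k f q) v)
      hT rfl
    beta_reduce at h3
    rw [(hT k).scanned] at h3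
    obtain ⟨T₂, h1', h2', h3'⟩ := ih (f v (S k).head?) h1
    exact ⟨T₂, h1', h2'.trans h2, h3.trans h3'⟩
  | load a q ih =>
    have h0 := reaches_idle (c := c) (ω := ω) (h := h) (T := T) (s := .run (.load a q) v) rfl
    obtain ⟨T₂, h1', h2', h3'⟩ := ih (a v) hT
    exact ⟨T₂, h1', h2', h0.trans h3'⟩
  | branch p q₁ q₂ ih₁ ih₂ =>
    have h0 := reaches_idle (c := c) (ω := ω) (h := h) (T := T) (s := .run (.branch p q₁ q₂) v) rfl
    cases hp : p v
    · obtain ⟨T₂, h1', h2', h3'⟩ := ih₂ v hT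
      rw [hp] at h0
      simp only [TM2.stepAux, hp]
      exact ⟨T₂, h1', h2', h0.trans h3'⟩
    · obtain ⟨T₂, h1', h2', h3'⟩ := ih₁ v hT
      rw [hp] at h0
      simp only [TM2.stepAux, hp]
      exact ⟨T₂, h1', h2', h0.trans h3'⟩
  | goto l =>
    exact ⟨T, hT, rfl, reaches_idle (c := c) (ω := ω) (h := h) (T := T) (s := .run (.goto l) v) rfl⟩
  | halt =>
    exact ⟨T, hT, rfl, reaches_idle (c := c) (ω := ω) (h := h) (T := T) (s := .run .halt v) rfl⟩

theorem reaches_TM2 {C D : Cf} (hC : Reaches (TM2.step prog) C D) (hT : Match T C.stk) :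
    ∃ T', Match T' D.stk ∧ T' .out = T .out ∧
      Reaches (rawStep c ω) ⟨(none, labelCtl C.l C.var), h, T⟩
        ⟨(none, labelCtl D.l D.var), h, T'⟩ := by
  induction hC with
  | refl => exact ⟨T, hT, rfl, .refl⟩
  | @tail D E _ hDE ih =>
    obtain ⟨T₁, h1, h2, h3⟩ := ih
    obtain ⟨l, v, S⟩ := D
    cases l with
    | none => cases hDE
    | some l =>
      cases hDE
      obtain ⟨T₂, h1', h2', h3'⟩ := reaches_stepAux (c := c) (ω := ω) (h := h) (prog l) v h1
      exact ⟨T₂, h1', h2'.trans h2, h3.trans h3'⟩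

end Steps

/-! ### Binary numerals as stacks -/

/-- Numerals have their least significant digit on top, so a push is N ↦ 2N + b and a pop halves.
Zero is excluded because its numeral is empty; the leading digit 1 in `num` and `code` avoids this
case and also preserves leading zeros of strings. -/
theorem trNat_two_mul {n : ℕ} (hn : 0 < n) : trNat (2 * n) = Γ'.bit0 :: trNat n := by
  have h2 : ((2 * n : ℕ) : Num) = Num.bit0 (n : Num) := by
    rw [two_mul, Nat.cast_add, Num.bit0_of_bit0]
  rw [trNat, trNat, h2]
  cases h : (n : Num) with
  | zero =>
    have := Num.to_of_nat n
    rw [h] at this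
    exact absurd this.symm hn.ne'
  | pos p => rfl

theorem trNat_two_mul_add_one (n : ℕ) : trNat (2 * n + 1) = Γ'.bit1 :: trNat n := by
  have h2 : ((2 * n + 1 : ℕ) : Num) = Num.bit1 (n : Num) := by
    rw [two_mul, Nat.cast_add, Nat.cast_add, ← Num.bit1_of_bit1, Nat.cast_one]
  rw [trNat, trNat, h2]
  cases (n : Num) <;> rfl

/-- The number with binary digits `1 w`. -/
def num (w : List Bool) : ℕ := w.foldl (fun n b => 2 * n + b.toNat) 1

/-- The number whose binary digits are `1` followed by the reverse of `x`. -/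
def code (x : List Bool) : ℕ := x.foldr (fun b n => 2 * n + b.toNat) 1

theorem num_concat (w : List Bool) (b : Bool) : num (w ++ [b]) = 2 * num w + b.toNat := by
  simp [num]

theorem code_eq (x : List Bool) : code x = num x.reverse := by
  simp [num, code, List.foldl_reverse]

theorem num_pos (w : List Bool) : 0 < num w := by
  induction w using List.reverseRecOn with
  | nil => simp [num]
  | append_singleton w b ih => rw [num_concat]; omega

theorem trNat_bit {n : ℕ} (hn : 0 < n) (b : Bool) :
    trNat (2 * n + b.toNat) = bitSym b :: trNat n := by
  cases b
  · exact trNat_two_mul hn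
  · exact trNat_two_mul_add_one n

/-- A one-way tape on which the string `u` has been written. -/
structure OutRep (τ : OneWayTape Sym) (u : List Bool) : Prop where
  head : τ.head = u.length
  cell : ∀ i, τ.cell i = (u[i]?).map bitSym

theorem OutRep.write {τ : OneWayTape Sym} {u : List Bool} (h : OutRep τ u) (b : Bool) :
    OutRep (τ.act (some (bitSym b)) .right) (u ++ [b]) := by
  refine ⟨by simp [OneWayTape.act, h.head], fun i => ?_⟩
  simp only [OneWayTape.act, h.head, Function.update_apply, h.cell]
  split_ifs with hi
  · subst hi; simp
  · rcases lt_or_gt_of_ne hi with hi | hi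
    · rw [List.getElem?_append_left hi]
    · rw [List.getElem?_eq_none (by omega), List.getElem?_eq_none (by simp; omega)]

/-! ### Rounds of the machine and the writing of its output -/

section Machine

variable {c : ToPartrec.Code} {ω : ℕ → Bool} {h : ℕ} {T : TapeName K' → OneWayTape Sym}

/-- The digits of `code x` come off the stack as x followed by the leading 1. Output lags one symbol
behind: a popped digit is written only after the next one is seen not to be the separator `cons`, so
the leading 1 is never written. -/
theorem reaches_emit (x u : List Bool)
    (hT : Match T (K'.elim (trList [code x]) [] [] [])) (hu : OutRep (T .out) u) :
    ∃ T' g, Match T' (K'.elim [Γ'.cons] [] [] []) ∧ OutRep (T' .out) (u ++ x) ∧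
      Reaches (rawStep c ω) ⟨(none, .hold), h, T⟩ ⟨(none, .emit g), h, T'⟩ := by
  induction x generalizing u T with
  | nil =>
    obtain ⟨T₁, h1, h2, h3⟩ := reaches_pop (c := c) (ω := ω) (h := h) (s := .hold) hT rfl
    refine ⟨T₁, _, ?_, by simpa [h2] using hu, h3⟩
    simpa [code, trNat, trNum, trPosNum] using h1
  | cons b x ih =>
    obtain ⟨T₁, h1, h2, h3⟩ := reaches_pop (c := c) (ω := ω) (h := h) (s := .hold) hT rfl
    have hc : trList [code (b :: x)] = bitSym b :: trList [code x] := by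
      have h0 : 0 < code x := by rw [code_eq]; exact num_pos _
      have := trNat_bit h0 b
      simpa [code, -List.cons_append] using congrArg (· ++ [Γ'.cons]) this
    have hm := (hT .main).scanned
    simp only [K'.elim_main, hc, List.head?_cons] at hm
    beta_reduce at h3
    rw [hm] at h3
    have h1' : Match T₁ (K'.elim (trList [code x]) [] [] []) := by
      convert h1 using 1
      simp only [K'.elim_main, K'.elim_update_main, hc, List.tail_cons]
    have hne : (T₁ (.work .main)).scanned ≠ some Γ'.cons := by
      rw [(h1' .main).scanned]
      have h0 : 0 < code x := by rw [code_eq]; exact num_pos _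
      rw [code_eq]
      rcases List.eq_nil_or_concat' x.reverse with e | ⟨l, a, e⟩
      · rw [e]; simp [num, trNat, trNum, trPosNum]
      · rw [e, num_concat]
        simp only [trList, K'.elim_main, trNat_bit (num_pos l)]
        cases a <;> simp [bitSym]
    set T₂ := Function.update T₁ .out ((T₁ .out).act (some (bitSym b)) .right) with hT₂
    have hs : Reaches (rawStep c ω) ⟨(none, .emit (bitSym b)), h, T₁⟩ ⟨(none, .hold), h, T₂⟩ := by
      refine .single ?_
      simp only [rawStep, trans, hne, if_false, hT₂]
      rfl
    have hM : Match T₂ (K'.elim (trList [code x]) [] [] []) := by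
      intro k
      rw [hT₂, Function.update_of_ne (by simp)]
      exact h1' k
    obtain ⟨T₃, g, e1, e2, e3⟩ := ih (u ++ [b]) hM (by
      rw [hT₂, Function.update_self]
      exact OutRep.write (by rw [h2]; exact hu) b)
    exact ⟨T₃, g, e1, by simpa using e2, (h3.trans hs).trans e3⟩

theorem reaches_round {w : List Bool} {r : ℕ}
    (hT : Match T (K'.elim (trList [num w]) [] [] []))
    (hr : c.eval [num (w ++ [ω h])] = pure [r]) :
    ∃ T', Match T' (K'.elim (trList [r]) [] [] []) ∧ T' .out = T .out ∧
      Reaches (rawStep c ω) ⟨(none, .read), h, T⟩ ⟨(none, .fin), h, T'⟩ := by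
  obtain ⟨T₁, h1, h2, h3⟩ := reaches_push (c := c) (ω := ω) (h := h) (s := .read) hT rfl
  have hin : Match T₁ (PartrecToTM2.init c [num (w ++ [ω h])]).stk := by
    convert h1 using 1
    simp only [PartrecToTM2.init, num_concat, trList, trNat_bit (num_pos w), K'.elim_update_main,
      K'.elim_main, List.cons_append]
  have he : PartrecToTM2.halt [r] ∈
      StateTransition.eval (TM2.step prog) (PartrecToTM2.init c [num (w ++ [ω h])]) := by
    have := PartrecToTM2.tr_eval c [num (w ++ [ω h])]
    rw [hr] at this
    change _ ∈ StateTransition.eval (TM2.step tr) _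
    rw [this]
    exact Part.mem_map _ (Part.mem_some _)
  obtain ⟨T₂, e1, e2, e3⟩ := reaches_TM2 (c := c) (ω := ω) (h := h)
    (StateTransition.mem_eval.1 he).1 hin
  exact ⟨T₂, e1, e2.trans h2, h3.trans e3⟩

end Machine

/-- On a proper nonempty prefix the even result 2N' has N' equal to the number of that prefix.
Popping its digit 0 restores the numeral to which the next bit is to be appended. -/
theorem exists_reaches_read (c : ToPartrec.Code) (ω : ℕ → Bool) (w : List Bool)
    (hω : ∀ i (hi : i < w.length), ω i = w[i])
    (hpre : ∀ w', w' <+: w → w' ≠ [] → w' ≠ w → c.eval [num w'] = pure [2 * num w'])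
    (k : ℕ) (hk : k < w.length) :
    ∃ T, Match T (K'.elim (trList [num (w.take k)]) [] [] []) ∧ OutRep (T .out) [] ∧
      Reaches (rawStep c ω) (toRaw ((machine c).init [])) ⟨(none, .read), k, T⟩ := by
  induction k with
  | zero =>
    have hT : Match ((machine c).init []).tape (K'.elim [] [] [] []) := by
      intro k
      cases k <;> exact ⟨rfl, rfl, by intro i a h; simp [K'.elim] at h⟩
    have hO : OutRep (((machine c).init []).tape .out) [] := ⟨rfl, fun i => rfl⟩
    obtain ⟨T₁, h1, h2, h3⟩ := reaches_push (c := c) (ω := ω) (h := 0) (s := .start) hT rfl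
    obtain ⟨T₂, h1', h2', h3'⟩ := reaches_push (c := c) (ω := ω) (h := 0) (s := .start') h1 rfl
    refine ⟨T₂, ?_, by rw [h2', h2]; exact hO, h3.trans h3'⟩
    convert h1' using 1
    simp [num, trNat, trNum, trPosNum]
  | succ k ih =>
    obtain ⟨T, h1, h2, h3⟩ := ih (by omega)
    have hw : w.take k ++ [ω k] = w.take (k + 1) := by
      rw [hω k (by omega), List.take_concat_get' w k (by omega)]
    have hr := hpre (w.take (k + 1)) (List.take_prefix _ _) (by
      intro h; have := congrArg List.length h; simp at this; rw [this] at hk; simp at hk) (by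
      intro h; have := congrArg List.length h; simp at this; omega)
    rw [← hw] at hr
    obtain ⟨T₁, e1, e2, e3⟩ := reaches_round h1 hr
    have hs : trList [2 * num (w.take k ++ [ω k])] =
        Γ'.bit0 :: trList [num (w.take (k + 1))] := by
      rw [hw]; simp [trNat_two_mul (num_pos _)]
    obtain ⟨T₂, f1, f2, f3⟩ := reaches_pop (c := c) (ω := ω) (h := k) (s := .fin) (s' := .read)
      (k := .main) (adv := true) e1 (by
        have := (e1 .main).scanned
        simp only [K'.elim_main, hs, List.head?_cons] at this
        simp [trans, this])
    refine ⟨T₂, ?_, by rw [f2, e2]; exact h2, (h3.trans e3).trans f3⟩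
    convert f1 using 1
    simp only [hs, K'.elim_update_main, K'.elim_main, List.tail_cons]

theorem machine_outputs {c : ToPartrec.Code} {w x : List Bool} (hw : w ≠ [])
    (hpre : ∀ w', w' <+: w → w' ≠ [] → w' ≠ w → c.eval [num w'] = pure [2 * num w'])
    (hfin : c.eval [num w] = pure [2 * code x + 1]) : (machine c).Outputs w [] x := by
  set ω : ℕ → Bool := fun i => w.getD i false with hω
  have hω' : ∀ i (hi : i < w.length), ω i = w[i] := fun i hi => by simp [hω, hi]
  obtain ⟨k, hk⟩ : ∃ k, w.length = k + 1 :=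
    Nat.exists_eq_succ_of_ne_zero (by simpa using hw)
  obtain ⟨T, h1, h2, h3⟩ := exists_reaches_read c ω w hω' hpre k (by omega)
  have hw' : w.take k ++ [ω k] = w := by
    rw [hω' k (by omega), List.take_concat_get' w k (by omega), List.take_of_length_le (by omega)]
  rw [← hw'] at hfin
  obtain ⟨T₁, e1, e2, e3⟩ := reaches_round h1 hfin
  have hs : trList [2 * code x + 1] = Γ'.bit1 :: trList [code x] := by
    simp [trNat_two_mul_add_one]
  -- The program head does not advance here: it stays on the last bit of w, at position |w| - 1, so
  -- that exactly w has been scanned.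
  obtain ⟨T₂, f1, f2, f3⟩ := reaches_pop (c := c) (ω := ω) (h := k) (s := .fin) (s' := .hold)
    (k := .main) (adv := false) e1 (by
      have := (e1 .main).scanned
      simp only [K'.elim_main, hs, List.head?_cons] at this
      simp [trans, this])
  have f1' : Match T₂ (K'.elim (trList [code x]) [] [] []) := by
    convert f1 using 1
    simp only [hs, K'.elim_update_main, K'.elim_main, List.tail_cons]
  obtain ⟨T₃, g, g1, g2, g3⟩ := reaches_emit (c := c) (ω := ω) (h := k) x [] f1'
    (by rw [f2, e2]; exact h2)
  obtain ⟨C, hC, hr⟩ := reaches_of_raw (((h3.trans e3).trans f3).trans g3)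
  obtain ⟨t, ht⟩ := exists_cfgAfter hr
  have hH : C.progHead = k := congrArg RawCfg.progHead hC
  have hT : C.tape = T₃ := congrArg RawCfg.tape hC
  refine ⟨t, t, le_rfl, C, ht, ?_, by omega, ?_, ?_⟩
  · have h0 := rawStep_toRaw ω C
    have hm := (g1 .main).scanned
    rw [hC] at h0
    simp only [rawStep, trans, hm, K'.elim_main, List.head?_cons, if_true, Option.map_none] at h0
    exact Option.map_eq_none_iff.1 h0.symm
  · intro i hi
    rw [hT]
    refine (g2.cell i).trans ?_
    simp [hi, machine]
  · intro b
    rw [hT]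
    refine ne_of_eq_of_ne (g2.cell _) ?_
    simp [machine]

end StackMachine

/-! ### Numbering of binary strings -/

namespace StackMachine

open Turing Turing.PartrecToTM2

theorem primrec_toNat : Primrec Bool.toNat := Primrec.dom_bool _

theorem primrec_num : Primrec num := by
  refine Primrec.list_foldl .id (.const 1) (Primrec.nat_add.comp (Primrec.nat_mul.comp (.const 2)
    (Primrec.fst.comp .snd)) (primrec_toNat.comp (Primrec.snd.comp .snd))).to₂

theorem primrec_code : Primrec code :=
  (primrec_num.comp Primrec.list_reverse).of_eq fun x => (code_eq x).symm

/-- One step of the computation of the string with a given number. -/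
def unnumStep (s : ℕ × List Bool) : ℕ × List Bool :=
  if s.1 ≤ 1 then s else (s.1 / 2, decide (s.1 % 2 = 1) :: s.2)

/-- The inverse of `num`. -/
def unnum (n : ℕ) : List Bool := (unnumStep^[n] (n, [])).2

theorem primrec_unnumStep : Primrec unnumStep := by
  refine Primrec.ite (Primrec.nat_le.comp .fst (.const 1)) .id (Primrec.pair
    (Primrec.nat_div.comp .fst (.const 2)) (Primrec.list_cons.comp ?_ .snd))
  exact (Primrec.eq.comp (Primrec.nat_mod.comp .fst (.const 2)) (.const 1)).decide

theorem primrec_unnum : Primrec unnum :=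
  Primrec.snd.comp (Primrec.nat_iterate .id (Primrec.pair .id (.const []))
    (primrec_unnumStep.comp .snd).to₂)

/-- Digits are removed at the low end, which rebuilds the string from its last bit. Surplus
iterations are harmless because the step fixes states with number 1; `length_le_num` shows that num
w iterations suffice. -/
theorem unnumStep_iterate (w l : List Bool) (k : ℕ) (hk : w.length ≤ k) :
    unnumStep^[k] (num w, l) = (1, w ++ l) := by
  induction w using List.reverseRecOn generalizing k l with
  | nil => exact Function.iterate_fixed (by simp [unnumStep, num]) k
  | append_singleton w b ih =>
    obtain ⟨k, rfl⟩ : ∃ k', k = k' + 1 := Nat.exists_eq_succ_of_ne_zero (by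
      rintro rfl; simp at hk)
    have h0 := num_pos w
    have h1 : unnumStep (num (w ++ [b]), l) = (num w, b :: l) := by
      rw [num_concat, unnumStep, if_neg (by simp only; omega)]
      cases b <;> simp
      omega
    rw [Function.iterate_succ_apply, h1, ih _ _ (by simpa using hk)]
    simp

theorem length_le_num (w : List Bool) : w.length ≤ num w := by
  induction w using List.reverseRecOn with
  | nil => simp
  | append_singleton w b ih => rw [num_concat]; have := num_pos w; simp; omega

theorem unnum_num (w : List Bool) : unnum (num w) = w := by
  rw [unnum, unnumStep_iterate _ _ _ (length_le_num w)]
  simp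

/-- A unary partial recursive function on natural numbers is computed by a code. -/
theorem exists_code_of_partrec {f : ℕ →. ℕ} (hf : Partrec f) :
    ∃ c : ToPartrec.Code, ∀ n, c.eval [n] = pure <$> f n := by
  obtain ⟨c, hc⟩ := ToPartrec.Code.exists_code (Nat.Partrec'.part_iff₁.2 hf)
  exact ⟨c, fun n => by simpa using! hc (n ::ᵥ List.Vector.nil)⟩

end StackMachine

/-! ### From partial recursive functions to programs of the universal machine -/

namespace PrefixTM

open StackMachine Turing

/-- A partial recursive function on strings, with values "read another bit" and "output `x`", is
computed by a prefix machine. -/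
theorem exists_outputs_of_partrec {F : List Bool →. Option (List Bool)} (hF : Partrec F) :
    ∃ T : PrefixTM, ∀ w x, w ≠ [] → (∀ w', w' <+: w → w' ≠ [] → w' ≠ w → none ∈ F w') →
      some x ∈ F w → T.Outputs w [] x := by
  obtain ⟨c, hc⟩ := exists_code_of_partrec (f := fun n => (F (unnum n)).map fun o =>
    o.elim (2 * n) fun x => 2 * code x + 1) (by
    refine Partrec.map (hF.comp primrec_unnum.to_comp) (Primrec.to_comp ?_)
    exact Primrec.option_casesOn Primrec.snd
      (Primrec.nat_mul.comp (.const 2) .fst) (Primrec.nat_double_succ.comp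
        (primrec_code.comp .snd)).to₂ |>.of_eq fun p => by cases p.2 <;> rfl)
  refine ⟨machine c, fun w x hw hpre hx => machine_outputs (c := c) hw ?_ ?_⟩
  · intro w' h1 h2 h3
    rw [hc, unnum_num, Part.eq_some_iff.2 (hpre w' h1 h2 h3)]
    simp
  · rw [hc, unnum_num, Part.eq_some_iff.2 hx]
    simp

theorem IsOptimalUniversal.exists_program {U : PrefixTM} (hU : U.IsOptimalUniversal)
    {F : List Bool →. Option (List Bool)} (hF : Partrec F) :
    ∃ c : ℕ, ∀ w x, w ≠ [] → (∀ w', w' <+: w → w' ≠ [] → w' ≠ w → none ∈ F w') → some x ∈ F w →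
      ∃ q : List Bool, q.length ≤ w.length + c ∧ U.Outputs q [] x := by
  obtain ⟨T, hT⟩ := exists_outputs_of_partrec hF
  obtain ⟨c, hc⟩ := hU T
  exact ⟨c, fun w x h1 h2 h3 => hc _ _ _ (hT w x h1 h2 h3)⟩

/-! ### Strings with a self-delimiting number in front -/

/-- One step of parsing a string `header n ++ u`. -/
def parseStep (s : ℕ × ℕ × List Bool) (b : Bool) : ℕ × ℕ × List Bool :=
  if s.1 = 0 then (if b then (0, s.2.1 + 16, s.2.2) else (1, s.2.1, s.2.2))
  else if s.1 = 1 then (if b then (1, s.2.1 + 1, s.2.2) else (2, s.2.1, s.2.2))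
  else (2, s.2.1, s.2.2 ++ [b])

/-- Parse a string `header n ++ u`. -/
def parse (w : List Bool) : ℕ × ℕ × List Bool := w.foldl parseStep (0, 0, [])

/-- A self-delimiting representation of `n`, of length about `n / 16`. -/
def header (n : ℕ) : List Bool :=
  List.replicate (n / 16) true ++ false :: (List.replicate (n % 16) true ++ [false])

theorem primrec_parseStep : Primrec₂ parseStep := by
  have n : Primrec fun p : (ℕ × ℕ × List Bool) × Bool => p.1.2.1 :=
    Primrec.fst.comp (Primrec.snd.comp Primrec.fst)
  have u : Primrec fun p : (ℕ × ℕ × List Bool) × Bool => p.1.2.2 :=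
    Primrec.snd.comp (Primrec.snd.comp Primrec.fst)
  have k : Primrec fun p : (ℕ × ℕ × List Bool) × Bool => p.1.1 :=
    Primrec.fst.comp Primrec.fst
  have b : Primrec fun p : (ℕ × ℕ × List Bool) × Bool => p.2 :=
    Primrec.snd
  have hb : PrimrecPred fun p : (ℕ × ℕ × List Bool) × Bool => p.2 = true :=
    Primrec.eq.comp b (.const true)
  refine Primrec.ite (Primrec.eq.comp k (.const 0)) (Primrec.ite hb ?_ ?_)
    (Primrec.ite (Primrec.eq.comp k (.const 1)) (Primrec.ite hb ?_ ?_) ?_)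
  · exact (Primrec.const 0).pair ((Primrec.nat_add.comp n (.const 16)).pair u)
  · exact (Primrec.const 1).pair (n.pair u)
  · exact (Primrec.const 1).pair ((Primrec.nat_add.comp n (.const 1)).pair u)
  · exact (Primrec.const 2).pair (n.pair u)
  · exact (Primrec.const 2).pair (n.pair (Primrec.list_concat.comp u b))

theorem primrec_parse : Primrec parse :=
  Primrec.list_foldl .id (.const (0, 0, [])) (primrec_parseStep.comp₂
    (Primrec.fst.comp .snd).to₂ (Primrec.snd.comp .snd).to₂)

theorem foldl_parseStep_zero (k n : ℕ) :
    (List.replicate k true).foldl parseStep (0, n, []) = (0, n + 16 * k, []) := by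
  induction k generalizing n with
  | zero => rfl
  | succ k ih =>
    rw [List.replicate_succ, List.foldl_cons, parseStep, if_pos rfl, if_pos rfl, ih]
    simp; omega

theorem foldl_parseStep_one (k n : ℕ) :
    (List.replicate k true).foldl parseStep (1, n, []) = (1, n + k, []) := by
  induction k generalizing n with
  | zero => rfl
  | succ k ih =>
    rw [List.replicate_succ, List.foldl_cons, parseStep, if_neg (by simp), if_pos rfl, if_pos rfl,
      ih]
    simp; omega

/-- Once the header is complete its number is frozen and all further bits are payload. Extending the
input can therefore only lengthen the payload. -/
theorem foldl_parseStep_two (r u : List Bool) (k n : ℕ) (hk : 2 ≤ k) :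
    (r.foldl parseStep (k, n, u)).2.2 = u ++ r ∧ (r.foldl parseStep (k, n, u)).2.1 = n ∧
      2 ≤ (r.foldl parseStep (k, n, u)).1 := by
  induction r generalizing u k with
  | nil => simp [hk]
  | cons b r ih =>
    rw [List.foldl_cons, parseStep, if_neg (by simp; omega), if_neg (by simp; omega)]
    have := ih (u ++ [b]) 2 le_rfl
    simpa using this

theorem parse_header (n : ℕ) : parse (header n) = (2, n, []) := by
  rw [parse, header, List.foldl_append, foldl_parseStep_zero, List.foldl_cons, List.foldl_append]
  rw [show parseStep (0, 0 + 16 * (n / 16), []) false = (1, 16 * (n / 16), []) by simp [parseStep],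
    foldl_parseStep_one]
  simp [parseStep, Nat.div_add_mod]

theorem parse_append {w : List Bool} (hw : 2 ≤ (parse w).1) (r : List Bool) :
    (parse (w ++ r)).2.2 = (parse w).2.2 ++ r ∧ (parse (w ++ r)).2.1 = (parse w).2.1 ∧
      2 ≤ (parse (w ++ r)).1 := by
  have := foldl_parseStep_two r (parse w).2.2 (parse w).1 (parse w).2.1 hw
  rwa [parse, List.foldl_append]

theorem length_header (n : ℕ) : (header n).length ≤ n / 16 + 17 := by
  simp [header]; omega

/-- A decoder that knows a number `n` is turned into programs, at the cost of the header. -/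
theorem IsOptimalUniversal.exists_program_header {U : PrefixTM} (hU : U.IsOptimalUniversal)
    {D : ℕ × List Bool →. Option (List Bool)} (hD : Partrec D) :
    ∃ c : ℕ, ∀ n u x, (∀ u', u' <+: u → u' ≠ u → none ∈ D (n, u')) → some x ∈ D (n, u) →
      ∃ q : List Bool, q.length ≤ n / 16 + u.length + c ∧ U.Outputs q [] x := by
  obtain ⟨c, hc⟩ := hU.exists_program
    (F := fun w => bif decide (2 ≤ (parse w).1) then D (parse w).2 else Part.some none) (by
      refine Partrec.cond ?_ (hD.comp (Primrec.snd.comp primrec_parse).to_comp)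
        (Computable.const none)
      exact ((Primrec.nat_le.comp (.const 2) (Primrec.fst.comp primrec_parse)).decide).to_comp)
  have h2 : ∀ n, 2 ≤ (parse (header n)).1 := fun n => by rw [parse_header]
  have hp : ∀ n u, (parse (header n ++ u)).2 = (n, u) := fun n u => by
    obtain ⟨h1, h3, -⟩ := parse_append (h2 n) u
    rw [parse_header] at h1 h3
    exact Prod.ext h3 (by simpa using h1)
  refine ⟨c + 17, fun n u x hu hx => ?_⟩
  have hpre : ∀ w', w' <+: header n ++ u → w' ≠ [] → w' ≠ header n ++ u → none ∈
      (bif decide (2 ≤ (parse w').1) then D (parse w').2 else Part.some none) := by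
    intro w' h1 _ h3
    by_cases hw : 2 ≤ (parse w').1
    · rw [decide_eq_true hw, cond_true]
      rcases List.prefix_or_prefix_of_prefix h1 (List.prefix_append (header n) u) with h | h
      · obtain ⟨r, hr⟩ := h
        -- If the parse is already complete on a prefix w' of the header, then the rest r of the
        -- header would be payload. The header has empty payload, so w' is the whole header.
        have h5 := (parse_append hw r).1
        rw [hr, parse_header] at h5
        have hr0 : r = [] := by
          have := congrArg List.length h5
          simp only [List.length_nil, List.length_append] at this
          exact List.length_eq_zero_iff.1 (by omega)
        subst hr0
        rw [List.append_nil] at hr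
        subst hr
        have := hp n []
        rw [List.append_nil] at this
        rw [this]
        exact hu [] List.nil_prefix (by rintro rfl; simp at h3)
      · obtain ⟨u', rfl⟩ := h
        rw [hp]
        exact hu u' ((List.prefix_append_right_inj _).1 h1) (by rintro rfl; exact h3 rfl)
    · rw [decide_eq_false hw, cond_false]
      exact Part.mem_some _
  obtain ⟨q, hq, ho⟩ := hc (header n ++ u) x (by simp [header]) hpre (by
    rw [decide_eq_true (parse_append (h2 n) u).2.2, cond_true, hp]
    exact hx)
  refine ⟨q, ?_, ho⟩
  have := length_header n
  rw [List.length_append] at hq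
  omega

end PrefixTM

/-! ### A computable simulation of a prefix machine -/

namespace PrefixTM

/-- A computable simulation of a prefix machine with empty auxiliary string: the position of the
program head and the output, if the machine has halted, after `t` steps with program tape `w`. -/
structure Simulator (U : PrefixTM) where
  head : List Bool → ℕ → ℕ
  res : List Bool → ℕ → Option (List Bool)
  primrec_head : Primrec₂ head
  primrec_res : Primrec₂ res
  outputsWithin_iff : ∀ d p x, U.OutputsWithin d p [] x ↔
    res p d = some x ∧ head p d + 1 = p.length
  head_mono : ∀ w, Monotone (head w)
  head_le : ∀ w t, head w t ≤ t
  stuck : ∀ w t x, res w t = some x → ∀ s ≥ t, res w s = some x ∧ head w s = head w t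
  congr : ∀ w w' k t, (∀ i < k, w.getD i false = w'.getD i false) → head w t < k →
    head w' t = head w t ∧ res w' t = res w t

namespace Sim

variable {Γ : Type}

/-- A one-way tape as a zipper: the cells left of the head in reverse order, and the cells from the
head on. -/
abbrev Zip (Γ : Type) := List Γ × List Γ

/-- The scanned symbol. -/
def zscan (bl : Γ) (z : Zip Γ) : Γ := z.2.head?.getD bl

/-- A number for a head move. -/
def moveIdx : HeadMove → ℕ
  | .left => 0
  | .stay => 1
  | .right => 2

/-- Write a symbol and move the head. -/
def zact (z : Zip Γ) (a : Γ) (m : HeadMove) : Zip Γ :=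
  if moveIdx m = 0 then (z.1.tail, z.1.head?.toList ++ a :: z.2.tail)
  else if moveIdx m = 1 then (z.1, a :: z.2.tail) else (a :: z.1, z.2.tail)

/-- A zipper represents a tape. -/
structure ZRep (bl : Γ) (z : Zip Γ) (τ : OneWayTape Γ) : Prop where
  head : τ.head = z.1.length
  cell : ∀ i, τ.cell i = (z.1.reverse ++ z.2).getD i bl

theorem ZRep.scan {bl : Γ} {z : Zip Γ} {τ : OneWayTape Γ} (h : ZRep bl z τ) :
    τ.scanned = zscan bl z := by
  rw [OneWayTape.scanned, h.cell, h.head, zscan, List.getD_eq_getElem?_getD,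
    List.getElem?_append_right (by simp)]
  simp [List.head?_eq_getElem?]

theorem update_getD (l r : List Γ) (a bl : Γ) (i : ℕ) :
    (l ++ a :: r.tail).getD i bl = Function.update (fun i => (l ++ r).getD i bl) l.length a i := by
  simp only [Function.update_apply, List.getD_eq_getElem?_getD]
  split_ifs with h
  · subst h; simp
  · rcases lt_or_gt_of_ne h with h | h
    · rw [List.getElem?_append_left h, List.getElem?_append_left h]
    · rw [List.getElem?_append_right h.le, List.getElem?_append_right h.le]
      obtain ⟨j, hj⟩ : ∃ j, i - l.length = j + 1 := ⟨i - l.length - 1, by omega⟩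
      rw [hj]
      simp

theorem ZRep.act {bl : Γ} {z : Zip Γ} {τ : OneWayTape Γ} (h : ZRep bl z τ) (a : Γ)
    (m : HeadMove) : ZRep bl (zact z a m) (τ.act a m) := by
  have key : ∀ i, Function.update τ.cell τ.head a i = (z.1.reverse ++ a :: z.2.tail).getD i bl := by
    intro i
    rw [update_getD, h.head, show τ.cell = _ from funext h.cell, List.length_reverse]
  obtain ⟨l, r⟩ := z
  cases m with
  | left =>
    refine ⟨by simp [OneWayTape.act, zact, moveIdx, h.head], fun i => (key i).trans ?_⟩
    cases l <;> simp [zact, moveIdx]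
  | stay =>
    exact ⟨by simp [OneWayTape.act, zact, moveIdx, h.head], fun i =>
      (key i).trans (by simp [zact, moveIdx])⟩
  | right =>
    exact ⟨by simp [OneWayTape.act, zact, moveIdx, h.head], fun i =>
      (key i).trans (by simp [zact, moveIdx])⟩

/-- An arbitrary coding of a finite type. -/
@[reducible] noncomputable def finiteCode (α : Type) [Finite α] : Primcodable α :=
  Primcodable.ofEquiv (Fin (Nat.card α)) (Finite.equivFin α)

instance : Finite HeadMove := Finite.of_surjective
  (fun i : Fin 3 => match i with | 0 => HeadMove.left | 1 => .stay | 2 => .right) (by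
    rintro (_ | _ | _)
    exacts [⟨0, rfl⟩, ⟨1, rfl⟩, ⟨2, rfl⟩])

instance {W : Type} [Finite W] : Finite (TapeName W) :=
  Finite.of_surjective (fun o : Option (Option W) => match o with
    | none => TapeName.aux
    | some none => TapeName.out
    | some (some w) => TapeName.work w) (by
      rintro (_ | _ | w)
      exacts [⟨none, rfl⟩, ⟨some none, rfl⟩, ⟨some (some w), rfl⟩])

noncomputable instance : Primcodable HeadMove := finiteCode _

theorem primrec_zact [Primcodable Γ] {α : Type*} [Primcodable α] {z : α → Zip Γ} {a : α → Γ}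
    {m : α → HeadMove} (hz : Primrec z) (ha : Primrec a) (hm : Primrec m) :
    Primrec fun x => zact (z x) (a x) (m x) := by
  have hi : Primrec fun x => moveIdx (m x) := (Primrec.dom_finite moveIdx).comp hm
  have h1 := Primrec.fst.comp hz
  have h2 := Primrec.list_cons.comp ha (Primrec.list_tail.comp (Primrec.snd.comp hz))
  refine Primrec.ite (Primrec.eq.comp hi (.const 0)) ?_
    (Primrec.ite (Primrec.eq.comp hi (.const 1)) ?_ ?_)
  · exact (Primrec.list_tail.comp h1).pair (Primrec.list_append.comp
      (Primrec.optionToList.comp (Primrec.list_head?.comp h1)) h2)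
  · exact h1.pair h2
  · exact (Primrec.list_cons.comp ha h1).pair (Primrec.list_tail.comp (Primrec.snd.comp hz))

variable (U : PrefixTM)

noncomputable instance : Primcodable U.Q := have := U.finite_Q; finiteCode _
noncomputable instance : Primcodable U.Γ := have := U.finite_Γ; finiteCode _
instance : Finite U.Q := U.finite_Q
instance : Finite U.Γ := U.finite_Γ
instance : Finite U.W := U.finite_W

/-- The number of tapes other than the program tape. -/
noncomputable abbrev tapes : ℕ := Nat.card (TapeName U.W)

/-- A numbering of these tapes. -/
noncomputable def idx : TapeName U.W ≃ Fin (tapes U) := Finite.equivFin _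

/-- Coded configurations. -/
abbrev CCfg := U.Q × ℕ × (Fin (tapes U) → Zip U.Γ)

/-- Coded actions. -/
abbrev CAct := U.Q × Bool × (Fin (tapes U) → U.Γ) × (Fin (tapes U) → HeadMove)

/-- The coded transition function. -/
noncomputable def ctrans (s : U.Q × Bool × (Fin (tapes U) → U.Γ)) : Option (CAct U) :=
  (U.δ s.1 s.2.1 fun i => s.2.2 (idx U i)).map fun a =>
    (a.next, a.advance, fun j => a.write ((idx U).symm j), fun j => a.move ((idx U).symm j))

/-- The action prescribed in a coded configuration. -/
noncomputable def cact (w : List Bool) (C : CCfg U) : Option (CAct U) :=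
  ctrans U (C.1, w.getD C.2.1 false, fun j => zscan U.blank (C.2.2 j))

/-- Perform an action. -/
def cdo (C : CCfg U) (a : CAct U) : CCfg U :=
  (a.1, C.2.1 + a.2.1.toNat, fun j => zact (C.2.2 j) (a.2.2.1 j) (a.2.2.2 j))

/-- A step of coded configurations; a halted configuration does not change. -/
noncomputable def cstep (w : List Bool) (C : CCfg U) : CCfg U := (cact U w C).elim C (cdo U C)

/-- The coded initial configuration. -/
def cinit : CCfg U := (U.start, 0, fun _ => ([], []))

/-- The coded configuration after `t` steps. -/
noncomputable def run (w : List Bool) (t : ℕ) : CCfg U := (cstep U w)^[t] (cinit U)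

/-- The bit denoted by a symbol. -/
noncomputable def bitInv (g : U.Γ) : Option Bool :=
  open Classical in if h : ∃ b, U.bit b = g then some h.choose else none

/-- The maximal binary string at the beginning of a list of symbols. -/
noncomputable def readBits (l : List U.Γ) : List Bool :=
  l.foldr (fun g acc => (bitInv U g).elim [] (· :: acc)) []

/-- The string on the output tape. -/
noncomputable def out (C : CCfg U) : List Bool :=
  readBits U ((C.2.2 (idx U .out)).1.reverse ++ (C.2.2 (idx U .out)).2)

variable {U}

theorem bitInv_eq_some {g : U.Γ} {b : Bool} : bitInv U g = some b ↔ U.bit b = g := by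
  unfold bitInv
  split_ifs with h
  · rw [Option.some_inj]
    constructor
    · rintro rfl; exact h.choose_spec
    · rintro rfl; exact U.bit_injective h.choose_spec
  · simp only [false_iff]
    exact fun hb => h ⟨b, hb⟩

theorem readBits_spec (l : List U.Γ) :
    (∀ i (h : i < (readBits U l).length), l.getD i U.blank = U.bit (readBits U l)[i]) ∧
      ∀ b, l.getD (readBits U l).length U.blank ≠ U.bit b := by
  induction l with
  | nil => simp [readBits, (U.bit_ne_blank _).symm]
  | cons g l ih =>
    have hr : readBits U (g :: l) = (bitInv U g).elim [] (· :: readBits U l) := rfl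
    cases hg : bitInv U g with
    | none =>
      rw [hr, hg]
      refine ⟨by simp, fun b hb => ?_⟩
      simp only [Option.elim_none, List.length_nil, List.getD_cons_zero] at hb
      rw [bitInv_eq_some.2 hb.symm] at hg
      cases hg
    | some b =>
      simp only [hr, hg, Option.elim_some]
      refine ⟨fun i hi => ?_, fun b' => by simpa using ih.2 b'⟩
      cases i with
      | zero => simpa using (bitInv_eq_some.1 hg).symm
      | succ i => simpa using ih.1 i (by simpa using hi)

theorem hasOutput_unique {C : U.Cfg} {x x' : List Bool} (h : C.HasOutput x)
    (h' : C.HasOutput x') : x = x' := by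
  have key : ∀ y y' : List Bool, C.HasOutput y → C.HasOutput y' → ¬ y.length < y'.length :=
    fun y y' hy hy' hlt => hy.2 _ (hy'.1 _ hlt)
  have hl : x.length = x'.length :=
    le_antisymm (not_lt.1 (key _ _ h' h)) (not_lt.1 (key _ _ h h'))
  refine List.ext_getElem hl fun i h1 h2 => U.bit_injective ?_
  rw [← h.1 i h1, ← h'.1 i h2]

/-- A coded configuration represents a configuration. -/
structure Rel (C : CCfg U) (D : U.Cfg) : Prop where
  state : C.1 = D.state
  head : C.2.1 = D.progHead
  tape : ∀ i, ZRep U.blank (C.2.2 (idx U i)) (D.tape i)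

theorem Rel.step {C : CCfg U} {D : U.Cfg} (h : Rel C D) (w : List Bool) :
    (U.step (fun i => w.getD i false) D = none ∧ cact U w C = none) ∨
      ∃ D', U.step (fun i => w.getD i false) D = some D' ∧ cact U w C ≠ none ∧
        Rel (cstep U w C) D' := by
  have hs : (fun i => zscan U.blank (C.2.2 (idx U i))) = fun i => (D.tape i).scanned :=
    funext fun i => ((h.tape i).scan).symm
  have ha : cact U w C = (U.δ D.state (w.getD D.progHead false) fun i => (D.tape i).scanned).map
      fun a => (a.next, a.advance, fun j => a.write ((idx U).symm j),
        fun j => a.move ((idx U).symm j)) := by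
    rw [cact, ctrans, hs, h.state, h.head]
  rw [PrefixTM.step]
  cases hd : U.δ D.state (w.getD D.progHead false) fun i => (D.tape i).scanned with
  | none => left; rw [ha, hd]; simp
  | some a =>
    right
    rw [hd] at ha
    refine ⟨_, rfl, by rw [ha]; simp, ?_⟩
    rw [cstep, ha]
    refine ⟨rfl, ?_, fun i => ?_⟩
    · simp only [cdo, Option.map_some, Option.elim_some, h.head]
      cases a.advance <;> simp
    · simpa [cdo] using (h.tape i).act (a.write i) (a.move i)

theorem rel_init : Rel (cinit U) (U.init []) := by
  refine ⟨rfl, rfl, fun i => ?_⟩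
  cases i <;> exact ⟨rfl, fun i => by simp [PrefixTM.init, cinit, inputTape]⟩

theorem run_succ (w : List Bool) (t : ℕ) : run U w (t + 1) = cstep U w (run U w t) :=
  Function.iterate_succ_apply' _ _ _

theorem cfgAfter_succ (ω : ℕ → Bool) (y : List Bool) (t : ℕ) :
    U.cfgAfter ω y (t + 1) = (U.cfgAfter ω y t).bind (U.step ω) :=
  Function.iterate_succ_apply' _ _ _

theorem cfgAfter_eq_none {ω : ℕ → Bool} {y : List Bool} {t s : ℕ} {D : U.Cfg}
    (h : U.cfgAfter ω y t = some D) (hD : U.step ω D = none) (hs : t < s) :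
    U.cfgAfter ω y s = none := by
  induction s, hs using Nat.le_induction with
  | base => rw [cfgAfter_succ, h]; exact hD
  | succ s _ ih => rw [cfgAfter_succ, ih]; rfl

/-- The coded run freezes where the machine's run becomes `none`, so after halting it represents an
earlier configuration, the halting one at time t'. -/
theorem exists_rel (w : List Bool) (t : ℕ) : ∃ t' ≤ t, ∃ D : U.Cfg,
    U.cfgAfter (fun i => w.getD i false) [] t' = some D ∧ Rel (run U w t) D ∧
      (t' = t ∨ U.step (fun i => w.getD i false) D = none) := by
  induction t with
  | zero => exact ⟨0, le_rfl, _, rfl, rel_init, .inl rfl⟩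
  | succ t ih =>
    obtain ⟨t', ht', D, h1, h2, h3⟩ := ih
    rcases h2.step w with ⟨h4, h5⟩ | ⟨D', h4, -, h5⟩
    · refine ⟨t', by omega, D, h1, ?_, .inr h4⟩
      rw [run_succ, cstep, h5]
      exact h2
    · obtain rfl : t' = t := h3.resolve_right (by rw [h4]; simp)
      refine ⟨t' + 1, le_rfl, D', ?_, by rw [run_succ]; exact h5, .inl rfl⟩
      rw [cfgAfter_succ, h1]
      exact h4

theorem Rel.hasOutput {C : CCfg U} {D : U.Cfg} (h : Rel C D) : D.HasOutput (out U C) := by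
  have := readBits_spec ((C.2.2 (idx U .out)).1.reverse ++ (C.2.2 (idx U .out)).2)
  exact ⟨fun i hi => ((h.tape .out).cell i).trans (this.1 i hi),
    fun b hb => this.2 b (((h.tape .out).cell _).symm.trans hb)⟩

theorem outputsWithin_iff (d : ℕ) (p x : List Bool) : U.OutputsWithin d p [] x ↔
    (cact U p (run U p d) = none ∧ out U (run U p d) = x) ∧ (run U p d).2.1 + 1 = p.length := by
  obtain ⟨t', ht', D, h1, h2, h3⟩ := exists_rel (U := U) p d
  constructor
  · rintro ⟨t, ht, c, hc, hs, hp, ho⟩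
    obtain rfl : t = t' := by
      rcases lt_trichotomy t t' with h | h | h
      · rw [cfgAfter_eq_none hc hs h] at h1; cases h1
      · exact h
      · rw [cfgAfter_eq_none h1 (h3.resolve_left (by omega)) h] at hc; cases hc
    rw [h1] at hc
    cases hc
    refine ⟨⟨?_, hasOutput_unique h2.hasOutput ho⟩, by rw [h2.head]; exact hp⟩
    rcases h2.step p with ⟨_, h5⟩ | ⟨D', h4, -⟩
    · exact h5
    · rw [hs] at h4; cases h4
  · rintro ⟨⟨h4, rfl⟩, h5⟩
    refine ⟨t', ht', D, h1, ?_, by rw [← h2.head]; exact h5, h2.hasOutput⟩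
    rcases h2.step p with ⟨h6, -⟩ | ⟨D', -, h7, -⟩
    · exact h6
    · exact absurd h4 h7

theorem run_add (w : List Bool) (t s : ℕ) (h : cact U w (run U w t) = none) :
    run U w (t + s) = run U w t := by
  induction s with
  | zero => rfl
  | succ s ih => rw [← add_assoc, run_succ, ih, cstep, h]; rfl

theorem head_cstep (w : List Bool) (C : CCfg U) :
    C.2.1 ≤ (cstep U w C).2.1 ∧ (cstep U w C).2.1 ≤ C.2.1 + 1 := by
  rw [cstep]
  cases cact U w C with
  | none => simp
  | some a => cases h : a.2.1 <;> simp [cdo, h]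

theorem head_run_mono (w : List Bool) : Monotone fun t => (run U w t).2.1 :=
  monotone_nat_of_le_succ fun t => by rw [run_succ]; exact (head_cstep w _).1

theorem cact_congr {w w' : List Bool} {C : CCfg U}
    (h : w.getD C.2.1 false = w'.getD C.2.1 false) : cact U w C = cact U w' C := by
  rw [cact, cact, h]

/-- The program head never moves left. If it is below k at time t, only bits below k have been
scanned so far. -/
theorem run_congr {w w' : List Bool} {k : ℕ} (h : ∀ i < k, w.getD i false = w'.getD i false)
    (t : ℕ) (ht : (run U w t).2.1 < k) : run U w' t = run U w t := by
  induction t with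
  | zero => rfl
  | succ t ih =>
    have h1 : (run U w t).2.1 < k := (head_run_mono w (Nat.le_succ t)).trans_lt ht
    rw [run_succ, run_succ, ih h1, cstep, cstep, cact_congr (h _ h1)]

-- The transition function is arbitrary, but between finite types every function is primitive
-- recursive. The codings of states and symbols were chosen without any structure for this reason.
variable (U) in
theorem primrec_ctrans : Primrec (ctrans U) := Primrec.dom_finite _

variable (U) in
theorem primrec_cact : Primrec₂ (cact U) := by
  refine (primrec_ctrans U).comp (Primrec.pair (Primrec.fst.comp .snd) (Primrec.pair
    ((Primrec.list_getD false).comp .fst (Primrec.fst.comp (Primrec.snd.comp .snd)))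
    (Primrec.fin_curry.2 ?_)))
  have hz : Primrec₂ fun (p : List Bool × CCfg U) (j : Fin (tapes U)) => p.2.2.2 j :=
    Primrec.fin_app.comp (Primrec.snd.comp (Primrec.snd.comp (Primrec.snd.comp .fst))) .snd
  exact (Primrec.option_getD.comp (Primrec.list_head?.comp (Primrec.snd.comp hz))
    (.const U.blank)).to₂

variable (U) in
theorem primrec_cdo : Primrec₂ (cdo U) := by
  refine Primrec.pair (Primrec.fst.comp .snd) (Primrec.pair
    (Primrec.nat_add.comp (Primrec.fst.comp (Primrec.snd.comp .fst))
      ((Primrec.dom_bool Bool.toNat).comp (Primrec.fst.comp (Primrec.snd.comp .snd))))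
    (Primrec.fin_curry.2 ?_))
  refine primrec_zact (α := (CCfg U × CAct U) × Fin (tapes U)) ?_ ?_ ?_
  · exact Primrec.fin_app.comp
      (Primrec.snd.comp (Primrec.snd.comp (Primrec.fst.comp .fst))) .snd
  · exact Primrec.fin_app.comp (Primrec.fst.comp
      (Primrec.snd.comp (Primrec.snd.comp (Primrec.snd.comp .fst)))) .snd
  · exact Primrec.fin_app.comp (Primrec.snd.comp
      (Primrec.snd.comp (Primrec.snd.comp (Primrec.snd.comp .fst)))) .snd

variable (U) in
theorem primrec_cstep : Primrec₂ (cstep U) :=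
  (Primrec.option_casesOn (primrec_cact U) Primrec.snd
    ((primrec_cdo U).comp (Primrec.snd.comp .fst) .snd).to₂).of_eq fun p => by
      rw [cstep]; cases cact U p.1 p.2 <;> rfl

variable (U) in
theorem primrec_run : Primrec₂ (run U) :=
  Primrec.nat_iterate .snd (.const (cinit U))
    ((primrec_cstep U).comp (Primrec.fst.comp .fst) .snd).to₂

variable (U) in
theorem primrec_readBits : Primrec (readBits U) := by
  have h : Primrec₂ fun (_ : List U.Γ) (p : U.Γ × List Bool) =>
      (bitInv U p.1).elim [] (· :: p.2) := by
    refine (Primrec.option_casesOn ((Primrec.dom_finite (bitInv U)).comp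
      (Primrec.fst.comp .snd)) (.const []) (Primrec.list_cons.comp .snd
        (Primrec.snd.comp (Primrec.snd.comp .fst))).to₂).of_eq fun p => ?_
    beta_reduce
    cases bitInv U p.2.1 <;> rfl
  exact Primrec.list_foldr .id (.const []) h

variable (U) in
theorem primrec_out : Primrec (out U) := by
  have h : Primrec fun C : CCfg U => C.2.2 (idx U .out) :=
    Primrec.fin_app.comp (Primrec.snd.comp .snd) (.const _)
  exact (primrec_readBits U).comp (Primrec.list_append.comp
    (Primrec.list_reverse.comp (Primrec.fst.comp h)) (Primrec.snd.comp h))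

variable (U) in
/-- The simulator obtained from the coded run. -/
noncomputable def simulator : Simulator U where
  head w t := (run U w t).2.1
  res w t := if (cact U w (run U w t)).isSome then none else some (out U (run U w t))
  primrec_head := Primrec.fst.comp (Primrec.snd.comp (primrec_run U))
  primrec_res := Primrec.ite (Primrec.eq.comp (Primrec.option_isSome.comp
      ((primrec_cact U).comp .fst (primrec_run U))) (.const true)) (.const none)
    (Primrec.option_some.comp ((primrec_out U).comp (primrec_run U)))
  outputsWithin_iff d p x := by
    rw [outputsWithin_iff]
    cases cact U p (run U p d) <;> simp
  head_mono := head_run_mono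
  head_le w t := by
    induction t with
    | zero => exact le_rfl
    | succ t ih =>
      rw [run_succ]
      exact (head_cstep w _).2.trans (by omega)
  stuck w t x h s hs := by
    obtain ⟨r, rfl⟩ := Nat.exists_eq_add_of_le hs
    have : cact U w (run U w t) = none := by
      by_contra hc
      rw [if_pos (Option.isSome_iff_ne_none.2 hc)] at h
      cases h
    rw [run_add w t r this]
    exact ⟨h, rfl⟩
  congr w w' k t h ht := by
    rw [run_congr h t ht, cact_congr (h _ ht)]
    exact ⟨rfl, rfl⟩

end Sim

end PrefixTM

namespace PrefixTM

/-! ### Composition of programs -/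

namespace Simulator

variable {U : PrefixTM} (S : Simulator U)

/-- The output after at most `t` steps, if the scanned program is exactly `p`. -/
def exact (p : List Bool) (t : ℕ) : Option (List Bool) :=
  if S.head p t + 1 = p.length then S.res p t else none

theorem exact_eq_some {p x : List Bool} {t : ℕ} :
    S.exact p t = some x ↔ U.OutputsWithin t p [] x := by
  rw [S.outputsWithin_iff, exact]
  split_ifs with h <;> simp [h]

theorem exact_mono {p x : List Bool} {t s : ℕ} (hts : t ≤ s) (h : S.exact p t = some x) :
    S.exact p s = some x := by
  rw [exact_eq_some] at *
  obtain ⟨t', ht', h⟩ := h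
  exact ⟨t', ht'.trans hts, h⟩

theorem mem_rfindOpt_exact {p x : List Bool} :
    x ∈ Nat.rfindOpt (S.exact p) ↔ U.Outputs p [] x := by
  rw [Nat.rfindOpt_mono (fun h => S.exact_mono h), Outputs]
  simp only [Option.mem_def, exact_eq_some]

theorem primrec_exact : Primrec₂ S.exact :=
  Primrec.ite (Primrec.eq.comp (Primrec.succ.comp S.primrec_head)
    (Primrec.list_length.comp .fst)) S.primrec_res (.const none)

/-- The machine run on a program of which only the part `w` is known: `none` if the run needs
another bit, `some x` if it has halted with output `x`. -/
def stage (w : List Bool) (t : ℕ) : Option (Option (List Bool)) :=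
  if w.length ≤ S.head w t then some none else (S.res w t).map some

theorem primrec_stage : Primrec₂ S.stage :=
  Primrec.ite (Primrec.nat_le.comp (Primrec.list_length.comp .fst) S.primrec_head)
    (.const (some none)) (Primrec.option_map S.primrec_res (Primrec.option_some.comp .snd).to₂)

theorem stage_mono {w : List Bool} {o : Option (List Bool)} {t s : ℕ} (hts : t ≤ s)
    (h : o ∈ S.stage w t) : o ∈ S.stage w s := by
  simp only [stage, Option.mem_def] at *
  split_ifs at h with h1
  · rw [if_pos (h1.trans (S.head_mono w hts)), h]
  · obtain ⟨x, hx, rfl⟩ := Option.map_eq_some_iff.1 h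
    obtain ⟨h2, h3⟩ := S.stuck w t x hx s hts
    rw [h3, if_neg h1, h2]
    rfl

theorem stage_program {q x : List Bool} (h : U.Outputs q [] x) :
    some x ∈ Nat.rfindOpt (S.stage q) := by
  obtain ⟨d, hd⟩ := h
  rw [S.outputsWithin_iff] at hd
  refine (Nat.rfindOpt_mono (fun h => S.stage_mono h)).2 ⟨d, ?_⟩
  rw [stage, if_neg (by omega), hd.1]
  rfl

theorem getD_append_of_lt (u r : List Bool) {i : ℕ} (hi : i < u.length) :
    u.getD i false = (u ++ r).getD i false := by
  simp [List.getD_eq_getElem?_getD, List.getElem?_append_left hi]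

/-- The run on q ends with the head on its last bit, which lies beyond w. The run on w padded with
`false` agrees with it as long as the head is inside w, so it must leave w too. -/
theorem stage_prefix {q w x : List Bool} (h : U.Outputs q [] x) (hw : w <+: q) (hne : w ≠ q) :
    none ∈ Nat.rfindOpt (S.stage w) := by
  obtain ⟨d, hd⟩ := h
  rw [S.outputsWithin_iff] at hd
  obtain ⟨r, rfl⟩ := hw
  have hr : r ≠ [] := by rintro rfl; simp at hne
  refine (Nat.rfindOpt_mono (fun h => S.stage_mono h)).2 ⟨d, ?_⟩
  rw [stage, if_pos, Option.mem_def]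
  by_contra hlt
  have := (S.congr w (w ++ r) w.length d (fun i => getD_append_of_lt w r) (by omega)).1
  have := List.length_pos_iff.2 hr
  rw [List.length_append] at hd
  omega

end Simulator

/-! ### Existence and incompressibility of shortest programs -/

section Levels

variable {U : PrefixTM}

/-- A program for a program of `x` yields a program of `x`. -/
theorem IsOptimalUniversal.exists_program_of_program (hU : U.IsOptimalUniversal) :
    ∃ c : ℕ, ∀ q p x, U.Outputs q [] p → U.Outputs p [] x →
      ∃ q' : List Bool, q'.length ≤ q.length + c ∧ U.Outputs q' [] x := by
  set S := Sim.simulator U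
  have hF : Partrec fun w => (Nat.rfindOpt (S.stage w)).bind fun o =>
      o.elim (Part.some none) fun p => (Nat.rfindOpt (S.exact p)).map some := by
    refine (Partrec.rfindOpt S.primrec_stage.to_comp).bind ?_
    refine (Partrec.optionCasesOn_right (o := fun a : List Bool × Option (List Bool) => a.2)
      (f := fun _ => none) (g := fun _ p => (Nat.rfindOpt (S.exact p)).map some)
      Computable.snd (Computable.const none) ?_).of_eq
        fun a => by obtain ⟨w, _ | p⟩ := a <;> rfl
    exact ((Partrec.rfindOpt S.primrec_exact.to_comp).comp Computable.snd).map
      (Computable.option_some.comp Computable.snd).to₂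
  obtain ⟨c, hc⟩ := hU.exists_program hF
  refine ⟨c, fun q p x hq hp => hc q x ?_ ?_ ?_⟩
  · rintro rfl
    obtain ⟨d, t, -, c, -, -, h, -⟩ := hq
    simp at h
  · intro w h1 _ h3
    exact Part.mem_bind_iff.2 ⟨none, S.stage_prefix hq h1 h3, Part.mem_some _⟩
  · refine Part.mem_bind_iff.2 ⟨some p, S.stage_program hq, ?_⟩
    exact (Part.mem_map_iff _).2 ⟨x, S.mem_rfindOpt_exact.2 hp, rfl⟩

/-- Every string has a program not much longer than the string itself. -/
theorem IsOptimalUniversal.exists_program_self (hU : U.IsOptimalUniversal) :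
    ∃ c : ℕ, ∀ x : List Bool, ∃ q : List Bool,
      q.length ≤ x.length / 16 + x.length + c ∧ U.Outputs q [] x := by
  have hD : Computable fun p : ℕ × List Bool => if p.2.length < p.1 then none else some p.2 :=
    (Primrec.ite (Primrec.nat_lt.comp (Primrec.list_length.comp .snd) .fst) (.const none)
      (Primrec.option_some.comp .snd)).to_comp
  obtain ⟨c, hc⟩ := hU.exists_program_header hD
  refine ⟨c, fun x => hc x.length x x (fun u h1 h2 => ?_) (by simp)⟩
  have : u.length < x.length :=
    lt_of_le_of_ne h1.length_le fun h => h2 (h1.eq_of_length h)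
  simp [this]

/-- An infimum in ℕ is attained only on a nonempty set (it is 0 on the empty set), so some program
for x is needed first. -/
theorem IsOptimalUniversal.exists_shortest (hU : U.IsOptimalUniversal) (x : List Bool) :
    ∃ p, U.IsShortestProgram p x := by
  obtain ⟨c, hc⟩ := hU.exists_program_self
  obtain ⟨q, -, hq⟩ := hc x
  obtain ⟨p, hp, hl⟩ := Nat.sInf_mem (s := {l | ∃ p : List Bool, U.Outputs p [] x ∧ p.length = l})
    ⟨_, q, hq, rfl⟩
  exact ⟨p, hp, hl⟩

theorem K_le {q x : List Bool} (h : U.Outputs q [] x) : U.K x ≤ q.length :=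
  Nat.sInf_le ⟨q, h, rfl⟩

/-- Shortest programs are incompressible up to a constant. -/
theorem IsOptimalUniversal.exists_forall_admissible (hU : U.IsOptimalUniversal) :
    ∃ c : ℕ, ∀ b ≥ c, ∀ x : List Bool, U.Admissible b x := by
  obtain ⟨c, hc⟩ := hU.exists_program_of_program
  refine ⟨c, fun b hb x => ?_⟩
  obtain ⟨p, hp, hpl⟩ := hU.exists_shortest x
  obtain ⟨q, hq, hql⟩ := hU.exists_shortest p
  obtain ⟨q', hq', ho⟩ := hc q p x hq hp
  have := K_le ho
  exact ⟨p, ⟨hp, hpl⟩, by rw [IsIncompressibleProgram]; omega⟩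

end Levels

end PrefixTM

/-! ### Interval coding -/

namespace PrefixTM

/-- The number with binary digits `u`. -/
def val (u : List Bool) : ℕ := u.foldl (fun n b => 2 * n + b.toNat) 0

theorem val_concat (u : List Bool) (b : Bool) : val (u ++ [b]) = 2 * val u + b.toNat := by
  simp [val]

/-- This is the nesting of dyadic intervals: the interval of an extension of u lies in the interval
of u. -/
theorem val_append (u r : List Bool) :
    val u * 2 ^ r.length ≤ val (u ++ r) ∧ val (u ++ r) + 1 ≤ (val u + 1) * 2 ^ r.length := by
  induction r using List.reverseRecOn with
  | nil => simp
  | append_singleton r b ih =>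
    rw [← List.append_assoc, val_concat, List.length_append, List.length_singleton, pow_succ]
    have := b.toNat_le
    constructor <;> nlinarith [ih.1, ih.2]

theorem exists_val_eq (l j : ℕ) (hj : j < 2 ^ l) : ∃ u : List Bool, u.length = l ∧ val u = j := by
  induction l generalizing j with
  | zero => exact ⟨[], rfl, by simp at hj; simp [val, hj]⟩
  | succ l ih =>
    obtain ⟨u, hu, hv⟩ := ih (j / 2) (by rw [pow_succ] at hj; omega)
    refine ⟨u ++ [decide (j % 2 = 1)], by simp [hu], ?_⟩
    rw [val_concat, hv]
    rcases Nat.mod_two_eq_zero_or_one j with h | h <;> simp [h] <;> omega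

/-- The common value of the entries of `L` with index in the dyadic interval given by `u`, for
indices with `E` binary digits. -/
def decodeInterval (L : List (List Bool)) (E : ℕ) (u : List Bool) : Option (List Bool) :=
  if ∀ i < 2 ^ (E - u.length), L[val u * 2 ^ (E - u.length) + i]? =
    L[val u * 2 ^ (E - u.length)]? then L[val u * 2 ^ (E - u.length)]? else none

theorem decodeInterval_eq_some {L : List (List Bool)} {E : ℕ} {u p : List Bool} :
    decodeInterval L E u = some p ↔
      ∀ i, val u * 2 ^ (E - u.length) ≤ i → i < (val u + 1) * 2 ^ (E - u.length) →
        L[i]? = some p := by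
  have h0 : 0 < 2 ^ (E - u.length) := by positivity
  constructor
  · intro h i h1 h2
    rw [decodeInterval] at h
    split_ifs at h with hc
    have := hc (i - val u * 2 ^ (E - u.length)) (by rw [add_mul] at h2; omega)
    rwa [h, Nat.add_sub_cancel' h1] at this
  · intro h
    have h1 := h _ le_rfl (by rw [add_mul]; omega)
    rw [decodeInterval, if_pos, h1]
    intro i hi
    rw [h1, h _ (by omega) (by rw [add_mul]; omega)]

/-- Among the entries of a list of length at most `2 ^ E`, an entry that is repeated `2 ^ k` times
in a row is described by at most `E - k + 1` bits. -/
theorem exists_decodeInterval {L L₁ L₂ : List (List Bool)} {E k : ℕ} {p : List Bool}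
    (hk : 0 < k) (hL : L = L₁ ++ List.replicate (2 ^ k) p ++ L₂) (hE : L.length ≤ 2 ^ E) :
    ∃ u : List Bool, u.length + k ≤ E + 1 ∧ decodeInterval L E u = some p ∧
      ∀ u', u' <+: u → u' ≠ u → decodeInterval L E u' = none := by
  obtain ⟨k, rfl⟩ := Nat.exists_eq_succ_of_ne_zero hk.ne'
  have hlen : L₁.length + 2 ^ (k + 1) ≤ 2 ^ E := by
    rw [hL] at hE
    simp at hE
    omega
  have hkE : k + 1 ≤ E := (Nat.pow_le_pow_iff_right (a := 2) (by norm_num)).1 (by omega)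
  have hget : ∀ i, L₁.length ≤ i → i < L₁.length + 2 ^ (k + 1) → L[i]? = some p := by
    intro i h1 h2
    rw [hL, List.append_assoc, List.getElem?_append_right h1,
      List.getElem?_append_left (by simp; omega), List.getElem?_replicate_of_lt (by omega)]
  -- After the substitution the block has 2^(k+1) entries. Rounding its start up to a multiple of
  -- 2^k leaves room for an aligned dyadic interval of length 2^k, hence an index with E - k digits.
  set j := (L₁.length + 2 ^ k - 1) / 2 ^ k with hj
  have h0 : 0 < 2 ^ k := by positivity
  have hj1 : L₁.length ≤ j * 2 ^ k := by
    have := Nat.lt_div_mul_add (a := L₁.length + 2 ^ k - 1) h0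
    rw [← hj] at this
    omega
  have hj2 : j * 2 ^ k ≤ L₁.length + 2 ^ k - 1 := Nat.div_mul_le_self _ _
  have hj3 : (j + 1) * 2 ^ k ≤ L₁.length + 2 ^ (k + 1) := by
    rw [add_mul, pow_succ]; omega
  have hjl : j < 2 ^ (E - k) := by
    by_contra hc
    have h1 : 2 ^ (E - k) * 2 ^ k ≤ j * 2 ^ k := Nat.mul_le_mul_right _ (not_lt.1 hc)
    rw [← pow_add, Nat.sub_add_cancel (by omega)] at h1
    rw [add_mul] at hj3
    omega
  obtain ⟨u, hul, hu⟩ := exists_val_eq _ _ hjl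
  have hs : E - u.length = k := by omega
  have hsome : decodeInterval L E u = some p := by
    rw [decodeInterval_eq_some, hs, hu]
    exact fun i h1 h2 => hget i (hj1.trans h1) (h2.trans_le hj3)
  -- The interval of a prefix contains that of u, so if its entries have a common value, that value
  -- is p.
  have hpre : ∀ u', u' <+: u → decodeInterval L E u' = none ∨
      decodeInterval L E u' = some p := by
    rintro u' ⟨r, hr⟩
    cases h : decodeInterval L E u' with
    | none => exact .inl rfl
    | some p' =>
      right
      rw [decodeInterval_eq_some] at h
      have hlr : E - u'.length = r.length + k := by
        have := congrArg List.length hr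
        rw [List.length_append] at this
        omega
      obtain ⟨h1, h2⟩ := val_append u' r
      rw [hr, hu] at h1 h2
      have h3 := Nat.mul_le_mul_right (2 ^ k) h1
      have h4 := Nat.mul_le_mul_right (2 ^ k) h2
      rw [mul_assoc, ← pow_add] at h3 h4
      rw [← hlr] at h3 h4
      have h5 := h (j * 2 ^ k) h3 (by rw [add_mul] at h4; omega)
      rw [hget _ hj1 (by rw [pow_succ]; omega)] at h5
      rw [Option.some_inj.1 h5]
  -- The shortest prefix of u that decodes to p has no proper prefix that decodes to anything, so
  -- the code is self-delimiting.
  have hex : ∃ l, ∃ u', u' <+: u ∧ u'.length = l ∧ decodeInterval L E u' = some p :=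
    ⟨_, u, List.prefix_rfl, rfl, hsome⟩
  classical
  obtain ⟨u₀, h1, h2, h3⟩ := Nat.find_spec hex
  refine ⟨u₀, ?_, h3, fun u' hu' hne => (hpre u' (hu'.trans h1)).resolve_right fun h => ?_⟩
  · have := h1.length_le
    omega
  · refine Nat.find_min hex (m := u'.length) ?_ ⟨u', hu'.trans h1, rfl, h⟩
    rw [← h2]
    exact lt_of_le_of_ne hu'.length_le fun h => hne (hu'.eq_of_length h)

/-! ### Strings of a given length -/

/-- All strings of length `n`, in lexicographic order. -/
def allStrings : ℕ → List (List Bool)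
  | 0 => [[]]
  | n + 1 => (allStrings n).map (List.cons false) ++ (allStrings n).map (List.cons true)

theorem mem_allStrings {n : ℕ} {s : List Bool} : s ∈ allStrings n ↔ s.length = n := by
  induction n generalizing s with
  | zero => simp [allStrings, List.length_eq_zero_iff]
  | succ n ih =>
    cases s with
    | nil => simp [allStrings]
    | cons b s => cases b <;> simp [allStrings, ih]

theorem length_allStrings (n : ℕ) : (allStrings n).length = 2 ^ n := by
  induction n with
  | zero => rfl
  | succ n ih => simp [allStrings, ih, pow_succ]; omega

theorem nodup_allStrings (n : ℕ) : (allStrings n).Nodup := by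
  induction n with
  | zero => simp [allStrings]
  | succ n ih =>
    refine List.nodup_append.2 ⟨ih.map (List.cons_injective), ih.map (List.cons_injective), ?_⟩
    intro a ha b hb
    obtain ⟨s, -, rfl⟩ := List.mem_map.1 ha
    obtain ⟨t, -, rfl⟩ := List.mem_map.1 hb
    simp

/-- The extensions of a string are contiguous in the lexicographic order. -/
theorem allStrings_eq_append (p : List Bool) (n : ℕ) : ∃ L₁ L₂,
    allStrings (p.length + n) = L₁ ++ (allStrings n).map (p ++ ·) ++ L₂ := by
  induction p with
  | nil => exact ⟨[], [], by simp⟩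
  | cons b p ih =>
    obtain ⟨L₁, L₂, h⟩ := ih
    have he : (b :: p).length + n = (p.length + n) + 1 := by simp; omega
    rw [he, allStrings, h]
    cases b
    · exact ⟨L₁.map (List.cons false), L₂.map (List.cons false) ++
        (L₁ ++ (allStrings n).map (p ++ ·) ++ L₂).map (List.cons true), by simp⟩
    · exact ⟨(L₁ ++ (allStrings n).map (p ++ ·) ++ L₂).map (List.cons false) ++
        L₁.map (List.cons true), L₂.map (List.cons true), by simp⟩

theorem primrec_allStrings : Primrec allStrings := by
  have h : Primrec₂ fun (_ : ℕ) (L : List (List Bool)) =>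
      L.map (List.cons false) ++ L.map (List.cons true) :=
    Primrec.list_append.comp
      (Primrec.list_map .snd (Primrec.list_cons.comp (.const false) .snd).to₂)
      (Primrec.list_map .snd (Primrec.list_cons.comp (.const true) .snd).to₂)
  refine (Primrec.nat_rec₁ [[]] h).of_eq fun n => ?_
  induction n with
  | zero => rfl
  | succ n ih => simp only [allStrings, ← ih]

theorem primrec_two_pow : Primrec fun n : ℕ => 2 ^ n :=
  (Primrec.list_length.comp primrec_allStrings).of_eq length_allStrings

theorem primrec_val : Primrec val :=
  Primrec.list_foldl .id (.const 0) (Primrec.nat_add.comp (Primrec.nat_mul.comp (.const 2)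
    (Primrec.fst.comp .snd)) (StackMachine.primrec_toNat.comp (Primrec.snd.comp .snd))).to₂

theorem primrec_decodeInterval :
    Primrec fun a : List (List Bool) × ℕ × List Bool => decodeInterval a.1 a.2.1 a.2.2 := by
  have hs : Primrec fun a : List (List Bool) × ℕ × List Bool => 2 ^ (a.2.1 - a.2.2.length) :=
    primrec_two_pow.comp (Primrec.nat_sub.comp (Primrec.fst.comp .snd)
      (Primrec.list_length.comp (Primrec.snd.comp .snd)))
  have hv : Primrec fun a : List (List Bool) × ℕ × List Bool =>
      val a.2.2 * 2 ^ (a.2.1 - a.2.2.length) :=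
    Primrec.nat_mul.comp (primrec_val.comp (Primrec.snd.comp .snd)) hs
  have hg : Primrec fun a : List (List Bool) × ℕ × List Bool =>
      a.1[val a.2.2 * 2 ^ (a.2.1 - a.2.2.length)]? := Primrec.list_getElem?.comp .fst hv
  refine Primrec.ite ?_ hg (.const none)
  have hR : PrimrecRel fun (i : ℕ) (a : List (List Bool) × ℕ × List Bool) =>
      a.1[val a.2.2 * 2 ^ (a.2.1 - a.2.2.length) + i]? =
        a.1[val a.2.2 * 2 ^ (a.2.1 - a.2.2.length)]? :=
    Primrec.eq.comp (Primrec.list_getElem?.comp (Primrec.fst.comp .snd)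
      (Primrec.nat_add.comp (hv.comp .snd) .fst)) (hg.comp .snd)
  exact ((hR.forall_mem_list).comp (Primrec.list_range.comp hs) .id).of_eq fun a => by simp

end PrefixTM

namespace PrefixTM

/-! ### Strings with programs that are short but slow -/

/-- The string of length `n` that consists of zeros followed by `z`. -/
def pad (n : ℕ) (z : List Bool) : List Bool := List.replicate (n - n / 4) false ++ z

theorem length_pad {n : ℕ} {z : List Bool} (hz : z.length = n / 4) : (pad n z).length = n := by
  simp [pad, hz]
  omega

theorem pad_injective (n : ℕ) : Function.Injective (pad n) :=
  fun _ _ h => List.append_cancel_left h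

theorem primrec_replicate_false : Primrec fun n : ℕ => List.replicate n false :=
  (Primrec.list_map Primrec.list_range (Primrec.const false).to₂).of_eq fun n => by simp

theorem primrec_div_four : Primrec fun n : ℕ => n / 4 :=
  Primrec.nat_div.comp .id (.const 4)

theorem primrec_pad : Primrec₂ pad :=
  Primrec.list_append.comp (primrec_replicate_false.comp (Primrec.nat_sub.comp .fst
    (primrec_div_four.comp .fst))) .snd

/-- The strings of length at most `N`. -/
def stringsUpTo (N : ℕ) : List (List Bool) := (List.range (N + 1)).flatMap allStrings

theorem mem_stringsUpTo {N : ℕ} {s : List Bool} : s ∈ stringsUpTo N ↔ s.length ≤ N := by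
  simp [stringsUpTo, mem_allStrings]

theorem primrec_stringsUpTo : Primrec stringsUpTo :=
  Primrec.list_flatMap (Primrec.list_range.comp Primrec.succ)
    (primrec_allStrings.comp .snd).to₂

theorem computable_decodeInterval {α : Type} [Primcodable α] {L : α → List (List Bool)}
    {E : α → ℕ} {u : α → List Bool} (hL : Computable L) (hE : Computable E) (hu : Computable u) :
    Computable fun a => decodeInterval (L a) (E a) (u a) :=
  primrec_decodeInterval.to_comp.comp (hL.pair (hE.pair hu))

/-! ### Lower bound for the drops in depth -/

section Drops

variable {U : PrefixTM}

/-- The header supplies n, and the n/4 bits of z follow; the zeros need no description. The total of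
about 5n/16 stays well below n. -/
theorem IsOptimalUniversal.exists_program_pad (hU : U.IsOptimalUniversal) :
    ∃ c : ℕ, ∀ n z, z.length = n / 4 → ∃ q : List Bool,
      q.length ≤ n / 16 + n / 4 + c ∧ U.Outputs q [] (pad n z) := by
  have hD : Computable fun p : ℕ × List Bool =>
      if p.2.length < p.1 / 4 then none else some (pad p.1 p.2) :=
    (Primrec.ite (Primrec.nat_lt.comp (Primrec.list_length.comp .snd)
      (primrec_div_four.comp .fst)) (.const none)
      (Primrec.option_some.comp (primrec_pad.comp .fst .snd))).to_comp
  obtain ⟨c, hc⟩ := hU.exists_program_header hD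
  refine ⟨c, fun n z hz => ?_⟩
  rw [← hz]
  refine hc n z _ (fun u h1 h2 => ?_) (by simp [hz])
  have : u.length < z.length :=
    lt_of_le_of_ne h1.length_le fun h => h2 (h1.eq_of_length h)
  simp [← hz, this]

/-- A computable bound for the time in which the padded strings are produced by some programs
that are shorter than the strings. -/
theorem IsOptimalUniversal.exists_computable_time (hU : U.IsOptimalUniversal) :
    ∃ (c : ℕ) (R : ℕ → ℕ), Computable R ∧ ∀ n z, z.length = n / 4 → ∃ q : List Bool,
      q.length ≤ n / 16 + n / 4 + c ∧ U.OutputsWithin (R n) q [] (pad n z) := by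
  set S := Sim.simulator U
  obtain ⟨c, hc⟩ := hU.exists_program_pad
  let P : ℕ → ℕ → Prop := fun n t => ∀ z ∈ allStrings (n / 4),
    ∃ q ∈ stringsUpTo (n / 16 + n / 4 + c), S.exact q t = some (pad n z)
  have hP : PrimrecRel P := by
    have h1 : PrimrecRel fun (q : List Bool) (a : List Bool × ℕ × ℕ) =>
        S.exact q a.2.2 = some (pad a.2.1 a.1) :=
      Primrec.eq.comp (S.primrec_exact.comp .fst (Primrec.snd.comp (Primrec.snd.comp .snd)))
        (Primrec.option_some.comp (primrec_pad.comp (Primrec.fst.comp (Primrec.snd.comp .snd))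
          (Primrec.fst.comp .snd)))
    have h2 : PrimrecRel fun (z : List Bool) (a : ℕ × ℕ) =>
        ∃ q ∈ stringsUpTo (a.1 / 16 + a.1 / 4 + c), S.exact q a.2 = some (pad a.1 z) :=
      h1.exists_mem_list.comp (f := fun b : List Bool × ℕ × ℕ =>
        stringsUpTo (b.2.1 / 16 + b.2.1 / 4 + c)) (g := id)
        (primrec_stringsUpTo.comp (Primrec.nat_add.comp (Primrec.nat_add.comp
          (Primrec.nat_div.comp (Primrec.fst.comp .snd) (.const 16))
          (primrec_div_four.comp (Primrec.fst.comp .snd))) (.const c))) .id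
    exact h2.forall_mem_list.comp (f := fun b : ℕ × ℕ => allStrings (b.1 / 4)) (g := id)
      (primrec_allStrings.comp (primrec_div_four.comp .fst)) .id
  have hex : ∀ n, ∃ t, P n t := by
    intro n
    have hall : ∀ z, ∃ t, z ∈ allStrings (n / 4) →
        ∃ q ∈ stringsUpTo (n / 16 + n / 4 + c), S.exact q t = some (pad n z) := by
      intro z
      by_cases hz : z ∈ allStrings (n / 4)
      · obtain ⟨q, hq, t, ht⟩ := hc n z (mem_allStrings.1 hz)
        exact ⟨t, fun _ => ⟨q, mem_stringsUpTo.2 hq, S.exact_eq_some.2 ht⟩⟩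
      · exact ⟨0, fun h => absurd h hz⟩
    choose t ht using hall
    refine ⟨(allStrings (n / 4)).toFinset.sup t, fun z hz => ?_⟩
    obtain ⟨q, hq, h⟩ := ht z hz
    exact ⟨q, hq, S.exact_mono (Finset.le_sup (List.mem_toFinset.2 hz)) h⟩
  classical
  have hr : Partrec fun n => Nat.rfind fun t => Part.some (decide (P n t)) :=
    Partrec.rfind (p := fun n t => Part.some (decide (P n t))) hP.decide.to_comp
  have hdom : ∀ n, (Nat.rfind fun t => Part.some (decide (P n t))).Dom := fun n => by
    obtain ⟨t, ht⟩ := hex n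
    exact Nat.rfind_dom'.2 ⟨t, by simpa using ht, fun _ => trivial⟩
  refine ⟨c, fun n => (Nat.rfind fun t => Part.some (decide (P n t))).get (hdom n),
    hr.of_eq fun n => (Part.some_get _).symm, fun n z hz => ?_⟩
  have h := Nat.rfind_spec (Part.get_mem (hdom n))
  obtain ⟨q, hq, h⟩ := (by simpa using h : P n _) z (mem_allStrings.2 hz)
  exact ⟨q, mem_stringsUpTo.1 hq, S.exact_eq_some.1 h⟩

namespace Simulator

variable (S : Simulator U)

/-- The program tapes of length `G + 2` that yield the output `x` within `G` steps. -/
def yielding (x : List Bool) (G : ℕ) : List (List Bool) :=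
  (allStrings (G + 2)).filter fun s => S.res s G = some x

theorem primrec_yielding : Primrec₂ S.yielding := by
  have h : PrimrecRel fun (s : List Bool) (a : List Bool × ℕ) => S.res s a.2 = some a.1 :=
    Primrec.eq.comp (S.primrec_res.comp .fst (Primrec.snd.comp .snd))
      (Primrec.option_some.comp (Primrec.fst.comp .snd))
  have h1 : Primrec fun a : List Bool × ℕ => S.yielding a.1 a.2 :=
    h.listFilter.comp (primrec_allStrings.comp (Primrec.nat_add.comp .snd (.const 2))) .id
  exact h1

/-- The list of the programs in `yielding`, each repeated for every program tape that begins
with it. -/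
def yieldingPrograms (x : List Bool) (G : ℕ) : List (List Bool) :=
  (S.yielding x G).map fun s => s.take (S.head s G + 1)

theorem primrec_yieldingPrograms : Primrec₂ S.yieldingPrograms :=
  Primrec.list_map S.primrec_yielding (Primrec.list_take.comp
    (Primrec.succ.comp (S.primrec_head.comp .snd (Primrec.snd.comp .fst))) .snd).to₂

/-- A run that scans exactly p ignores all later bits, so every tape extending p yields x and
contributes p again. These tapes are contiguous in lexicographic order, whence a block of
2^(G+2-|p|) copies. -/
theorem yieldingPrograms_eq_append {p x : List Bool} {G : ℕ} (h : S.exact p G = some x) :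
    p.length ≤ G + 1 ∧ ∃ L₁ L₂, S.yieldingPrograms x G =
      L₁ ++ List.replicate (2 ^ (G + 2 - p.length)) p ++ L₂ := by
  rw [exact] at h
  split_ifs at h with hl
  have hle := S.head_le p G
  refine ⟨by omega, ?_⟩
  obtain ⟨L₁, L₂, hL⟩ := allStrings_eq_append p (G + 2 - p.length)
  rw [Nat.add_sub_cancel' (by omega)] at hL
  refine ⟨(L₁.filter fun s => S.res s G = some x).map fun s => s.take (S.head s G + 1),
    (L₂.filter fun s => S.res s G = some x).map fun s => s.take (S.head s G + 1), ?_⟩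
  have hc : ∀ r, S.head (p ++ r) G = S.head p G ∧ S.res (p ++ r) G = S.res p G := fun r =>
    S.congr p (p ++ r) p.length G (fun i => getD_append_of_lt p r) (by omega)
  have h1 : ((allStrings (G + 2 - p.length)).map (p ++ ·)).filter
      (fun s => S.res s G = some x) = (allStrings (G + 2 - p.length)).map (p ++ ·) := by
    refine List.filter_eq_self.2 fun s hs => ?_
    obtain ⟨r, -, rfl⟩ := List.mem_map.1 hs
    simp [(hc r).2, h]
  rw [yieldingPrograms, yielding, hL, List.filter_append, List.filter_append, h1,
    List.map_append, List.map_append, List.map_map]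
  congr 2
  rw [List.eq_replicate_iff]
  refine ⟨by simp [length_allStrings], fun s hs => ?_⟩
  obtain ⟨r, -, rfl⟩ := List.mem_map.1 hs
  simp [(hc r).1, hl]

/-- A string `z` such that few program tapes yield the padded string. -/
def rare (n G : ℕ) : List Bool :=
  ((allStrings (n / 4)).filter fun z =>
    (S.yielding (pad n z) G).length ≤ 2 ^ (G + 2 - n / 4)).head?.getD []

theorem primrec_rare : Primrec₂ S.rare := by
  have h : PrimrecRel fun (z : List Bool) (a : ℕ × ℕ) =>
      (S.yielding (pad a.1 z) a.2).length ≤ 2 ^ (a.2 + 2 - a.1 / 4) :=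
    Primrec.nat_le.comp (Primrec.list_length.comp (S.primrec_yielding.comp
      (primrec_pad.comp (Primrec.fst.comp .snd) .fst) (Primrec.snd.comp .snd)))
      (primrec_two_pow.comp (Primrec.nat_sub.comp (Primrec.nat_add.comp (Primrec.snd.comp .snd)
        (.const 2)) (primrec_div_four.comp (Primrec.fst.comp .snd))))
  have h1 : Primrec fun a : ℕ × ℕ => S.rare a.1 a.2 :=
    Primrec.option_getD.comp (Primrec.list_head?.comp (h.listFilter.comp
      (primrec_allStrings.comp (primrec_div_four.comp .fst)) .id)) (.const [])
  exact h1

theorem rare_spec {n G : ℕ} (hG : n ≤ G) : (S.rare n G).length = n / 4 ∧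
    (S.yielding (pad n (S.rare n G)) G).length ≤ 2 ^ (G + 2 - n / 4) := by
  have hex : ∃ z ∈ allStrings (n / 4),
      (S.yielding (pad n z) G).length ≤ 2 ^ (G + 2 - n / 4) := by
    have hcard : (((allStrings (n / 4)).toFinset.image fun z => some (pad n z))).card =
        2 ^ (n / 4) := by
      rw [Finset.card_image_of_injective (f := fun z => some (pad n z)) _
          ((Option.some_injective _).comp (pad_injective n)),
        List.toFinset_card_of_nodup (nodup_allStrings _), length_allStrings]
    have hne : ((allStrings (n / 4)).toFinset.image fun z => some (pad n z)).Nonempty := by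
      rw [← Finset.card_pos, hcard]
      positivity
    -- Pigeonhole: 2^(G+2) tapes are distributed over 2^(n/4) distinct candidate outputs.
    obtain ⟨y, hy, h⟩ := Finset.exists_card_fiber_le_of_card_le_mul
      (s := (allStrings (G + 2)).toFinset) (f := fun s => S.res s G)
      (n := 2 ^ (G + 2 - n / 4)) hne (by
        rw [hcard, List.toFinset_card_of_nodup (nodup_allStrings _), length_allStrings,
          ← pow_add, Nat.add_sub_cancel' (by omega)])
    obtain ⟨z, hz, rfl⟩ := Finset.mem_image.1 hy
    refine ⟨z, List.mem_toFinset.1 hz, le_of_eq_of_le ?_ h⟩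
    rw [yielding, ← List.toFinset_card_of_nodup ((nodup_allStrings _).filter _),
      List.toFinset_filter]
    congr 1
    ext s
    simp
  obtain ⟨z, hz, h⟩ := hex
  have hmem : z ∈ (allStrings (n / 4)).filter fun z =>
      (S.yielding (pad n z) G).length ≤ 2 ^ (G + 2 - n / 4) := by
    simp [hz, h]
  have hr : S.rare n G ∈ (allStrings (n / 4)).filter fun z =>
      (S.yielding (pad n z) G).length ≤ 2 ^ (G + 2 - n / 4) := by
    rw [rare]
    cases hl : (allStrings (n / 4)).filter fun z =>
      (S.yielding (pad n z) G).length ≤ 2 ^ (G + 2 - n / 4) with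
    | nil => rw [hl] at hmem; simp at hmem
    | cons a l => simp
  simpa [mem_allStrings] using hr

end Simulator

/-- For a computable time bound there are strings with the property that all their programs that
halt within the bound are compressible. -/
theorem IsOptimalUniversal.exists_rare (hU : U.IsOptimalUniversal) {G : ℕ → ℕ}
    (hG : Computable G) (hn : ∀ n, n ≤ G n) : ∃ c : ℕ, ∀ n, ∃ z : List Bool, z.length = n / 4 ∧
      ∀ p, U.OutputsWithin (G n) p [] (pad n z) → U.K p + n / 4 ≤ n / 16 + p.length + c := by
  set S := Sim.simulator U
  have hD : Computable fun a : ℕ × List Bool =>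
      decodeInterval (S.yieldingPrograms (pad a.1 (S.rare a.1 (G a.1))) (G a.1))
        (G a.1 + 2 - a.1 / 4) a.2 := by
    have h1 : Computable fun a : ℕ × List Bool => G a.1 := hG.comp .fst
    have h2 : Computable fun a : ℕ × List Bool => S.rare a.1 (G a.1) :=
      S.primrec_rare.to_comp.comp .fst h1
    have h3 : Computable fun a : ℕ × List Bool =>
        S.yieldingPrograms (pad a.1 (S.rare a.1 (G a.1))) (G a.1) :=
      S.primrec_yieldingPrograms.to_comp.comp (primrec_pad.to_comp.comp .fst h2) h1
    have h4 : Computable fun a : ℕ × List Bool => G a.1 + 2 - a.1 / 4 :=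
      Primrec.nat_sub.to_comp.comp (Primrec.nat_add.to_comp.comp h1 (.const 2))
        (primrec_div_four.to_comp.comp .fst)
    exact computable_decodeInterval h3 h4 .snd
  obtain ⟨c, hc⟩ := hU.exists_program_header hD
  refine ⟨c + 1, fun n => ?_⟩
  obtain ⟨hz, hlen⟩ := S.rare_spec (hn n)
  refine ⟨_, hz, fun p hp => ?_⟩
  obtain ⟨hpl, L₁, L₂, hL⟩ := S.yieldingPrograms_eq_append (S.exact_eq_some.2 hp)
  -- At most G steps scan at most G + 1 bits, so tapes of length G + 2 make the exponent G + 2 - |p|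
  -- positive. The code has at most (G + 2 - n/4) - (G + 2 - |p|) + 1 = |p| - n/4 + 1 bits.
  obtain ⟨u, hu, h1, h2⟩ := exists_decodeInterval (k := G n + 2 - p.length) (by omega) hL
    (by rwa [Simulator.yieldingPrograms, List.length_map])
  obtain ⟨q, hq, hqp⟩ := hc n u p
    (fun u' h3 h4 => by simpa using (h2 u' h3 h4).symm) (by simpa using h1.symm)
  have := K_le hqp
  have := hn n
  omega

/-- A total drop of more than `(m + 1) * g` over `m + 1` levels contains a drop of more
than `g`. -/
theorem exists_lt_sub_succ (d : ℕ → ℕ) (g k m : ℕ) (h : d (k + m + 1) + (m + 1) * g < d k) :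
    ∃ b, k ≤ b ∧ b ≤ k + m ∧ g < d b - d (b + 1) := by
  induction m with
  | zero => exact ⟨k, le_rfl, le_rfl, by simp at h; omega⟩
  | succ m ih =>
    by_cases hb : g < d (k + (m + 1)) - d (k + (m + 1) + 1)
    · exact ⟨_, by omega, le_rfl, hb⟩
    · obtain ⟨b, h1, h2, h3⟩ := ih (by
        rw [add_mul (m + 1), one_mul] at h
        rw [show k + m + 1 = k + (m + 1) by omega]
        omega)
      exact ⟨b, h1, by omega, h3⟩

/-- The maximal drop in logical depth outgrows every computable function. -/
theorem IsOptimalUniversal.eventually_lt_maxDepthDrop (hU : U.IsOptimalUniversal) {g : ℕ → ℕ}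
    (hg : Computable g) : ∀ᶠ n in atTop, g n < U.maxDepthDrop n := by
  obtain ⟨c₁, hc₁⟩ := hU.exists_forall_admissible
  obtain ⟨c₂, R, hR, hRs⟩ := hU.exists_computable_time
  have hG : Computable fun n => R n + (n + 1) * g n + n :=
    Primrec.nat_add.to_comp.comp (Primrec.nat_add.to_comp.comp hR
      (Primrec.nat_mul.to_comp.comp Primrec.succ.to_comp hg)) .id
  obtain ⟨c₃, hc₃⟩ := hU.exists_rare hG fun n => by omega
  -- The bound only has to ensure c₁ ≤ n, n/16 + n/4 + c₂ ≤ n + 1 and c₁ + c₃ < n/4 - n/16.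
  filter_upwards [eventually_ge_atTop (100 * (c₁ + c₂ + c₃ + 1))] with n hn
  obtain ⟨z, hz, hzp⟩ := hc₃ n
  obtain ⟨q, hq, hqz⟩ := hRs n z hz
  have hlow : U.logicalDepth (n + 1) (pad n z) ≤ R n :=
    Nat.sInf_le ⟨q, hqz, by rw [IsIncompressibleProgram]; omega⟩
  -- Otherwise a c₁-incompressible program would halt within G(n), although such programs are
  -- compressible by n/4 - n/16 - c₃ bits.
  have hhigh : R n + (n + 1) * g n + n < U.logicalDepth c₁ (pad n z) := by
    by_contra hle
    obtain ⟨p, ⟨t, ht, h⟩, hpi⟩ := Nat.sInf_mem (hc₁ c₁ le_rfl (pad n z)).exists_time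
    have := hzp p ⟨t, ht.trans (not_lt.1 hle), h⟩
    rw [IsIncompressibleProgram] at hpi
    omega
  obtain ⟨b, hb1, hb2, hb⟩ := exists_lt_sub_succ (fun b => U.logicalDepth b (pad n z)) (g n) c₁
    (n - c₁) (by
      rw [show c₁ + (n - c₁) + 1 = n + 1 by omega]
      have : (n - c₁ + 1) * g n ≤ (n + 1) * g n := Nat.mul_le_mul_right _ (by omega)
      omega)
  exact hb.trans_le (le_csSup (finite_depthDrops U n).bddAbove
    ⟨pad n z, b, length_pad hz, by omega, hc₁ b hb1 _, rfl⟩)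

end Drops

end PrefixTM

/-! ### Two-symbol machines -/

namespace TwoSymbol

open Turing

/-- The transition table of a two-symbol machine with states `σ`. -/
abbrev Table (σ : Type) := σ → Bool → Bool × Dir × Option σ

/-- The displacement of the head. -/
def disp : Dir → ℤ
  | .left => -1
  | .right => 1

variable {σ : Type}

/-- A step that does not halt, for configurations that consist of the state, the position of the
head and the contents of the tape. -/
def Step (M : Table σ) (c c' : σ × ℤ × (ℤ → Bool)) : Prop :=
  ∃ b d, M c.1 (c.2.2 c.2.1) = (b, d, some c'.1) ∧ c'.2.1 = c.2.1 + disp d ∧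
    c'.2.2 = Function.update c.2.2 c.2.1 b

/-- Finitely many steps. -/
abbrev Run (M : Table σ) := Relation.ReflTransGen (Step M)

theorem Step.right {M : Table σ} {q q' : σ} {i : ℤ} {f : ℤ → Bool}
    (h : M q (f i) = (f i, .right, some q')) : Step M (q, i, f) (q', i + 1, f) :=
  ⟨_, _, h, rfl, (Function.update_eq_self _ _).symm⟩

theorem Step.left {M : Table σ} {q q' : σ} {i : ℤ} {f : ℤ → Bool}
    (h : M q (f i) = (f i, .left, some q')) : Step M (q, i, f) (q', i - 1, f) :=
  ⟨_, _, h, rfl, (Function.update_eq_self _ _).symm⟩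

theorem Step.write {M : Table σ} {q q' : σ} {i i' : ℤ} {f f' : ℤ → Bool} {b b' : Bool} {d : Dir}
    (hb : f i = b) (h : M q b = (b', d, some q')) (hi : i' = i + disp d)
    (hf : f' = Function.update f i b') : Step M (q, i, f) (q', i', f') :=
  ⟨_, _, by rw [← hb] at h; exact h, hi, hf⟩

/-- Walking right as long as a property of the cell holds. -/
theorem Run.rightwards {M : Table σ} {f : ℤ → Bool} (q : ℤ → σ) {i k : ℤ} (hik : i ≤ k)
    (h : ∀ j, i ≤ j → j < k → M (q j) (f j) = (f j, .right, some (q (j + 1)))) :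
    Run M (q i, i, f) (q k, k, f) := by
  obtain ⟨n, rfl⟩ := Int.le.dest hik
  clear hik
  induction n with
  | zero => simpa using Relation.ReflTransGen.refl
  | succ n ih =>
    refine (ih fun j h1 h2 => h j h1 (by push_cast; omega)).tail ?_
    have := Step.right (h (i + n) (by omega) (by push_cast; omega))
    rw [add_assoc] at this
    exact_mod_cast this

/-- Walking left as long as a property of the cell holds. -/
theorem Run.leftwards {M : Table σ} {f : ℤ → Bool} (q : ℤ → σ) {i k : ℤ} (hik : k ≤ i)
    (h : ∀ j, k < j → j ≤ i → M (q j) (f j) = (f j, .left, some (q (j - 1)))) :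
    Run M (q i, i, f) (q k, k, f) := by
  obtain ⟨n, rfl⟩ := Int.le.dest hik
  clear hik
  induction n with
  | zero => simpa using Relation.ReflTransGen.refl
  | succ n ih =>
    refine .head ?_ (ih fun j h1 h2 => h j h1 (by push_cast; omega))
    have := Step.left (h (k + (n + 1 : ℕ)) (by push_cast; omega) le_rfl)
    rwa [show k + ((n + 1 : ℕ) : ℤ) - 1 = k + n by push_cast; omega] at this

/-! ### Loading a string onto the tape -/

/-- The states of the loader other than those that hold the data; `run` enters the states of a
machine that works on the loaded string. -/
inductive Ctl (l : ℕ) (V Λ : Type)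
  | seek (v : V) (o : ZMod l)
  | put (v : V) (o : ZMod l)
  | back (o : ZMod l)
  | extend
  | turn
  | rewind
  | erase
  | find
  | enter
  | run (q : Λ)

instance {l : ℕ} [NeZero l] {V Λ : Type} [Finite V] [Finite Λ] : Finite (Ctl l V Λ) := by
  let f : Ctl l V Λ → (V × ZMod l) ⊕ (V × ZMod l) ⊕ ZMod l ⊕ Fin 6 ⊕ Λ := fun
    | .seek v o => .inl (v, o)
    | .put v o => .inr (.inl (v, o))
    | .back o => .inr (.inr (.inl o))
    | .extend => .inr (.inr (.inr (.inl 0)))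
    | .turn => .inr (.inr (.inr (.inl 1)))
    | .rewind => .inr (.inr (.inr (.inl 2)))
    | .erase => .inr (.inr (.inr (.inl 3)))
    | .find => .inr (.inr (.inr (.inl 4)))
    | .enter => .inr (.inr (.inr (.inl 5)))
    | .run q => .inr (.inr (.inr (.inr q)))
  refine Finite.of_injective f fun a b h => ?_
  cases a <;> cases b <;> simp_all [f]

variable {V Λ : Type} {l m : ℕ}

/-- The loader writes the chunks of the data in turn from cell `0` on. The number of the chunks
written so far is kept in unary left of cell `-l`, and selects the state that holds the next
datum. -/
def loader (l m : ℕ) (chunk : V → List Bool) (data : ℕ → V) (R : Table Λ) (q₀ : Λ) :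
    Table (Fin (m + 1) ⊕ Ctl l V Λ)
  | .inl j, true => (true, .right, some (.inl (Fin.ofNat _ (j + 1))))
  | .inl j, false => if (j : ℕ) < m then (false, .right, some (.inr (.seek (data j) 1)))
      else (false, .left, some (.inr .rewind))
  | .inr (.seek v o), b => if o = 0 ∧ b = false then (true, .right, some (.inr (.put v 1)))
      else (b, .right, some (.inr (.seek v (o + 1))))
  | .inr (.put v o), _ => if o + 1 = 0
      then ((chunk v).getD o.val false, .left, some (.inr (.back (o - 1))))
      else ((chunk v).getD o.val false, .right, some (.inr (.put v (o + 1))))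
  | .inr (.back o), b => if o = 0 ∧ b = false then (b, .left, some (.inr .extend))
      else (b, .left, some (.inr (.back (o - 1))))
  | .inr .extend, true => (true, .left, some (.inr .extend))
  | .inr .extend, false => (true, .left, some (.inr .turn))
  | .inr .turn, b => (b, .right, some (.inl 0))
  | .inr .rewind, true => (true, .left, some (.inr .rewind))
  | .inr .rewind, false => (false, .right, some (.inr .erase))
  | .inr .erase, true => (false, .right, some (.inr .erase))
  | .inr .erase, false => (false, .right, some (.inr .find))
  | .inr .find, true => (true, .left, some (.inr .enter))
  | .inr .find, false => (false, .right, some (.inr .find))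
  | .inr .enter, b => (b, .right, some (.inr (.run q₀)))
  | .inr (.run q), b => ((R q b).1, (R q b).2.1, (R q b).2.2.map (.inr ∘ .run))

/-- The tape with the counter `c` and the string `w`. -/
def layout (l c : ℕ) (w : List Bool) (i : ℤ) : Bool :=
  if 0 ≤ i then w.getD i.toNat false else decide (-l - c ≤ i ∧ i < -l)

theorem layout_nonneg {c : ℕ} {w : List Bool} {i : ℕ} : layout l c w i = w.getD i false := by
  simp [layout]

theorem layout_counter {c : ℕ} {w : List Bool} {i : ℤ} (h1 : -l - c ≤ i) (h2 : i < -l) :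
    layout l c w i = true := by
  rw [layout, if_neg (by omega)]
  simp [h1, h2]

theorem layout_outside {c : ℕ} {w : List Bool} {i : ℤ} (h0 : i < 0) (h : i < -l - c ∨ -l ≤ i) :
    layout l c w i = false := by
  rw [layout, if_neg (by omega), decide_eq_false_iff_not]
  omega

theorem update_layout_append (c : ℕ) (w : List Bool) (b : Bool) :
    Function.update (layout l c w) w.length b = layout l c (w ++ [b]) := by
  funext i
  rcases eq_or_ne i w.length with rfl | h
  · rw [Function.update_self, layout_nonneg]
    simp
  · rw [Function.update_of_ne h, layout, layout]
    split_ifs with h0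
    · lift i to ℕ using h0
      have hi : i ≠ w.length := by exact_mod_cast h
      rcases lt_or_gt_of_ne hi with h | h
      · simp [List.getD_eq_getElem?_getD, List.getElem?_append_left h]
      · rw [List.getD_eq_default _ _ (by simp; omega), List.getD_eq_default _ _ (by simp; omega)]
    · rfl

theorem update_layout_succ (c : ℕ) (w : List Bool) :
    Function.update (layout l c w) (-l - c - 1) true = layout l (c + 1) w := by
  funext i
  rcases eq_or_ne i (-l - c - 1) with rfl | h
  · rw [Function.update_self, layout_counter (by push_cast; omega) (by omega)]
  · rw [Function.update_of_ne h, layout, layout]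
    split_ifs with h0
    · rfl
    · rw [decide_eq_decide]
      push_cast
      omega

theorem update_layout_pred (c : ℕ) (w : List Bool) :
    Function.update (layout l (c + 1) w) (-l - c - 1) false = layout l c w := by
  rw [← update_layout_succ, Function.update_idem, Function.update_eq_self_iff,
    layout_outside (by omega) (by omega)]

variable {chunk : V → List Bool} {data : ℕ → V} {R : Table Λ} {q₀ : Λ}

theorem take_append_getD {w : List Bool} {o : ℕ} (h : o < w.length) :
    w.take o ++ [w.getD o false] = w.take (o + 1) := by
  rw [List.take_add_one, List.getD_eq_getElem?_getD, List.getElem?_eq_getElem h]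
  rfl

/-- The first `j` chunks. -/
def chunks (chunk : V → List Bool) (data : ℕ → V) (j : ℕ) : List Bool :=
  (List.range j).flatMap fun i => chunk (data i)

theorem chunks_succ (j : ℕ) :
    chunks chunk data (j + 1) = chunks chunk data j ++ chunk (data j) := by
  simp [chunks, List.range_succ]

theorem length_chunks (hl : ∀ v, (chunk v).length = l) (j : ℕ) :
    (chunks chunk data j).length = j * l := by
  induction j with
  | zero => simp [chunks]
  | succ j ih => rw [chunks_succ, List.length_append, ih, hl]; ring

theorem chunks_getD (hl : ∀ v, (chunk v).length = l) (h1 : ∀ v, (chunk v).getD 0 false = true)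
    {j k : ℕ} (hk : k < j) : (chunks chunk data j).getD (k * l) false = true := by
  have h0 : 0 < l := by
    rw [← hl (data 0), List.length_pos_iff]
    intro h
    simpa [h] using h1 (data 0)
  induction j with
  | zero => omega
  | succ j ih =>
    rw [chunks_succ, List.getD_eq_getElem?_getD]
    rcases Nat.lt_succ_iff_lt_or_eq.1 hk with h | rfl
    · rw [List.getElem?_append_left, ← List.getD_eq_getElem?_getD, ih h]
      rw [length_chunks hl]
      exact Nat.mul_lt_mul_of_pos_right h h0
    · rw [List.getElem?_append_right (by rw [length_chunks hl]), length_chunks hl, Nat.sub_self,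
        ← List.getD_eq_getElem?_getD, h1]

theorem layout_chunks_of_dvd (hl : ∀ v, (chunk v).length = l)
    (h1 : ∀ v, (chunk v).getD 0 false = true) {c j : ℕ} {i : ℤ} (h0 : 0 ≤ i) (hi : i < j * l)
    (hd : (l : ℤ) ∣ i) : layout l c (chunks chunk data j) i = true := by
  lift i to ℕ using h0
  obtain ⟨k, rfl⟩ := Int.natCast_dvd_natCast.1 hd
  rw [layout_nonneg, mul_comm, chunks_getD hl h1]
  by_contra h
  have := Nat.mul_le_mul_right l (not_lt.1 h)
  rw [mul_comm l k] at hi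
  norm_cast at hi
  omega

/-- All chunks have the length `l` and begin with `1`. -/
structure IsChunk (l : ℕ) (chunk : V → List Bool) : Prop where
  length_eq : ∀ v, (chunk v).length = l
  head_eq : ∀ v, (chunk v).getD 0 false = true
  two_le : 2 ≤ l

section Load

local notation "Mach" => loader l m chunk data R q₀

/-- Crossing the j ones of the counter raises the index of the state from 0 to j, and thereby
selects the state whose transition holds datum j. No wrap-around occurs, as j ≤ m. -/
theorem run_count {j : ℕ} (hj : j ≤ m) (w : List Bool) :
    Run Mach (.inl 0, -l - j, layout l j w) (.inl (Fin.ofNat _ j), -l, layout l j w) := by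
  have := Run.rightwards (M := Mach) (f := layout l j w)
    (fun i => .inl (Fin.ofNat (m + 1) (i + l + j).toNat)) (i := -l - j) (k := -l) (by omega) (by
      intro i h1 h2
      rw [layout_counter h1 h2, loader]
      congr 4
      apply Fin.ext
      simp only [Fin.val_ofNat]
      rw [Nat.mod_eq_of_lt (a := (i + l + j).toNat) (by omega)]
      congr 1
      omega)
  have h0 : (-(l : ℤ) - j + l + j).toNat = 0 := by omega
  rw [h0] at this
  simpa using this

/-- Every written chunk begins with 1, so the first zero at an offset divisible by l is the first
free cell. The walk starts at offset 1, past the blank cell -l. -/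
theorem run_seek (hc : IsChunk l chunk) (v : V) (j : ℕ) (c : ℕ) :
    Run Mach (.inr (.seek v 1), -l + 1, layout l c (chunks chunk data j))
      (.inr (.put v 1), (j * l : ℕ) + 1,
        layout l c (chunks chunk data j ++ [true])) := by
  obtain ⟨hl, h1, hl2⟩ := hc
  have h := Run.rightwards (M := Mach) (f := layout l c (chunks chunk data j))
    (fun i => .inr (.seek v (i : ZMod l))) (i := -l + 1) (k := (j * l : ℕ)) (by push_cast; nlinarith) (by
      intro i h2 h3
      rw [loader, if_neg, Int.cast_add, Int.cast_one]
      rintro ⟨h4, h5⟩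
      rw [ZMod.intCast_zmod_eq_zero_iff_dvd] at h4
      have h0 : 0 ≤ i := by
        obtain ⟨k, rfl⟩ := h4
        have : 0 < (k + 1) := by
          by_contra hk
          nlinarith
        nlinarith
      rw [layout_chunks_of_dvd hl h1 h0 (by exact_mod_cast h3) h4] at h5
      cases h5)
  simp only [Int.cast_add, Int.cast_neg, Int.cast_natCast, ZMod.natCast_self, neg_zero, zero_add,
    Int.cast_one, Nat.cast_mul] at h
  refine Relation.ReflTransGen.tail (by simpa using h) ?_
  refine Step.write (b := false) (b' := true) (d := .right) ?_ ?_ ?_ ?_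
  · rw [← Nat.cast_mul, layout_nonneg, List.getD_eq_default]
    rw [length_chunks hl]
  · simp [loader]
  · simp [disp]
  · rw [← update_layout_append, length_chunks hl, Nat.cast_mul]

theorem run_put (hc : IsChunk l chunk) (v : V) (w : List Bool) (c o : ℕ) (ho : 1 ≤ o) (hol : o < l) :
    Run Mach (.inr (.put v 1), w.length + 1, layout l c (w ++ [true]))
      (.inr (.put v o), w.length + o, layout l c (w ++ (chunk v).take o)) := by
  obtain ⟨hl, h1, hl2⟩ := hc
  have hval : ∀ o < l, (o : ZMod l).val = o := fun o h => by
    rw [ZMod.val_natCast, Nat.mod_eq_of_lt h]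
  have hstep : ∀ o < l, (chunk v).take o ++ [(chunk v).getD o false] = (chunk v).take (o + 1) :=
    fun o h => take_append_getD (by rwa [hl])
  induction o, ho using Nat.le_induction with
  | base =>
    rw [← hstep 0 (by omega), h1]
    simpa using Relation.ReflTransGen.refl
  | succ o ho ih =>
    refine (ih (by omega)).tail ?_
    refine Step.write rfl (b' := (chunk v).getD o false) (d := .right) ?_ ?_ ?_
    · rw [loader, if_neg, hval o (by omega)]
      · simp
      · rw [← Nat.cast_one, ← Nat.cast_add, ZMod.natCast_eq_zero_iff]
        exact Nat.not_dvd_of_pos_of_lt (by omega) hol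
    · simp [disp, add_assoc]
    · rw [← hstep o (by omega), ← List.append_assoc, ← update_layout_append, List.length_append,
        List.length_take, hl, min_eq_left (by omega), Nat.cast_add]

theorem run_back (hc : IsChunk l chunk) (v : V) (w : List Bool) (hw : l ∣ w.length) (c : ℕ) :
    Run Mach (.inr (.put v (l - 1 : ℕ)), w.length + (l - 1 : ℕ),
        layout l c (w ++ (chunk v).take (l - 1)))
      (.inr (.back ((w.length + (l - 1 : ℕ) : ℤ) - 1 : ℤ)), w.length + (l - 1 : ℕ) - 1,
        layout l c (w ++ chunk v)) := by
  obtain ⟨hl, h1, hl2⟩ := hc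
  refine .single (Step.write rfl (b' := (chunk v).getD (l - 1) false) (d := .left) ?_ ?_ ?_)
  · have h2 : ((l - 1 : ℕ) : ZMod l) + 1 = 0 := by
      rw [← Nat.cast_one (R := ZMod l), ← Nat.cast_add, ZMod.natCast_eq_zero_iff, Nat.sub_add_cancel (by omega)]
    have h3 : ((l - 1 : ℕ) : ZMod l).val = l - 1 := by
      rw [ZMod.val_natCast, Nat.mod_eq_of_lt (by omega)]
    rw [loader, if_pos h2, h3]
    congr 4
    have h4 : ((w.length : ℕ) : ZMod l) = 0 := (ZMod.natCast_eq_zero_iff _ _).2 hw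
    push_cast
    rw [h4, zero_add]
  · simp [disp]; ring
  · have h2 : chunk v = (chunk v).take (l - 1) ++ [(chunk v).getD (l - 1) false] := by
      rw [take_append_getD (by rw [hl]; omega), Nat.sub_add_cancel (by omega),
        List.take_of_length_le (hl v).le]
    conv_lhs => rw [h2]
    rw [← List.append_assoc, ← update_layout_append, List.length_append,
      List.length_take, hl, min_eq_left (by omega), Nat.cast_add]

/-- From the last chunk back to the state that starts a round. -/
theorem run_return (hc : IsChunk l chunk) (j c : ℕ) (i : ℤ) (hi : -l ≤ i) (hij : i < j * l) :
    Run Mach (.inr (.back i), i, layout l c (chunks chunk data j))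
      (.inl 0, -l - (c + 1 : ℕ), layout l (c + 1) (chunks chunk data j)) := by
  obtain ⟨hl, h1, hl2⟩ := hc
  -- Going left, the first blank cell at an offset divisible by l is cell -l: all such cells from 0
  -- on that are passed carry the leading 1 of a chunk.
  have h := Run.leftwards (M := Mach) (f := layout l c (chunks chunk data j))
    (fun i => .inr (.back (i : ZMod l))) (i := i) (k := -l) hi (by
      intro i h2 h3
      rw [loader, if_neg, Int.cast_sub, Int.cast_one]
      rintro ⟨h4, h5⟩
      rw [ZMod.intCast_zmod_eq_zero_iff_dvd] at h4
      have h0 : 0 ≤ i := by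
        obtain ⟨k, rfl⟩ := h4
        have : 0 < (k + 1) := by
          by_contra hk
          nlinarith
        nlinarith
      rw [layout_chunks_of_dvd hl h1 h0 (by omega) h4] at h5
      cases h5)
  refine h.trans ?_
  refine Relation.ReflTransGen.head (b := (.inr .extend, (-l - 1 : ℤ), layout l c (chunks chunk data j)))
    (Step.left ?_) ?_
  · rw [layout_outside (by omega) (by omega)]
    simp [loader]
  refine Relation.ReflTransGen.trans (Run.leftwards (M := Mach) (fun _ => .inr .extend)
    (i := -l - 1) (k := -l - c - 1) (by omega) fun i h2 h3 => ?_) ?_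
  · rw [layout_counter (by omega) (by omega), loader]
  -- Each transition moves the head, so it overshoots the new end of the counter by one cell and
  -- `turn` brings it back.
  refine Relation.ReflTransGen.head (b := (.inr .turn, (-l - c - 1 - 1 : ℤ),
    layout l (c + 1) (chunks chunk data j))) (Step.write (b := false) (b' := true) (d := .left)
      (layout_outside (by omega) (by omega)) rfl (by simp [disp]; ring)
      (update_layout_succ _ _).symm) ?_
  refine Relation.ReflTransGen.single ?_
  have := Step.right (M := Mach) (q := .inr .turn) (q' := .inl 0) (i := -l - c - 1 - 1)
    (f := layout l (c + 1) (chunks chunk data j)) rfl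
  rw [sub_add_cancel] at this
  rwa [Nat.cast_add, Nat.cast_one, ← sub_sub]

theorem run_round (hc : IsChunk l chunk) {j : ℕ} (hj : j < m) :
    Run Mach (.inl 0, -l - j, layout l j (chunks chunk data j))
      (.inl 0, -l - (j + 1 : ℕ), layout l (j + 1) (chunks chunk data (j + 1))) := by
  obtain ⟨hl, h1, hl2⟩ := id hc
  have hlen : (chunks chunk data j).length = j * l := length_chunks hl j
  have hdvd : l ∣ (chunks chunk data j).length := hlen ▸ dvd_mul_left _ _
  refine (run_count hj.le _).trans (.head (b := (.inr (.seek (data j) 1), (-l + 1 : ℤ),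
    layout l j (chunks chunk data j))) (Step.right ?_) ?_)
  · rw [layout_outside (by omega) (by omega), loader]
    have : ((Fin.ofNat (m + 1) j : Fin (m + 1)) : ℕ) = j := Nat.mod_eq_of_lt (by omega)
    rw [this, if_pos hj]
  refine (run_seek hc _ j j).trans ?_
  have h2 := run_put (m := m) (data := data) (R := R) (q₀ := q₀) hc (data j)
    (chunks chunk data j) j (l - 1) (by omega) (by omega)
  rw [hlen] at h2
  refine h2.trans ?_
  have h3 := run_back (m := m) (data := data) (R := R) (q₀ := q₀) hc (data j) _ hdvd j
  rw [hlen] at h3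
  refine h3.trans ?_
  rw [← chunks_succ]
  refine run_return hc (j + 1) j _ ?_ ?_
  · push_cast; nlinarith
  · rw [Nat.cast_sub (by omega)]; push_cast; nlinarith

/-- The loader, started on the blank tape, starts the machine `R` on the tape with the chunks of
the data. -/
theorem run_loader (hc : IsChunk l chunk) (hm : 0 < m) : Run Mach (.inl 0, -l, fun _ => false)
    (.inr (.run q₀), 0, layout l 0 (chunks chunk data m)) := by
  obtain ⟨hl, h1, hl2⟩ := id hc
  have h2 : ∀ j ≤ m, Run Mach (.inl 0, -l, fun _ => false)
      (.inl 0, -l - j, layout l j (chunks chunk data j)) := by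
    intro j hj
    induction j with
    | zero =>
      have : layout l 0 (chunks chunk data 0) = fun _ => false := by
        funext i
        rw [layout]
        split_ifs
        · simp [chunks]
        · rw [decide_eq_false_iff_not]
          omega
      rw [this]
      simpa using Relation.ReflTransGen.refl
    | succ j ih => exact (ih (by omega)).trans (run_round hc (by omega))
  have h3 : ∀ c : ℕ, Run Mach (.inr .erase, -l - c, layout l c (chunks chunk data m))
      (.inr .erase, -l, layout l 0 (chunks chunk data m)) := by
    intro c
    induction c with
    | zero => simpa using Relation.ReflTransGen.refl
    | succ c ih =>
      refine .head ?_ ih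
      refine Step.write (b := true) (b' := false) (d := .right)
        (layout_counter (by omega) (by push_cast; omega)) rfl (by simp [disp]; ring) ?_
      rw [← update_layout_pred]
      congr 1
      push_cast
      ring
  refine (h2 m le_rfl).trans ((run_count le_rfl _).trans ?_)
  refine .head (b := (.inr .rewind, (-l - 1 : ℤ), layout l m (chunks chunk data m))) (Step.left ?_) ?_
  · rw [layout_outside (by omega) (by omega), loader]
    have : ((Fin.ofNat (m + 1) m : Fin (m + 1)) : ℕ) = m := Nat.mod_eq_of_lt (by omega)
    rw [this, if_neg (lt_irrefl _)]
  refine Relation.ReflTransGen.trans (Run.leftwards (M := Mach) (fun _ => .inr .rewind)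
    (i := -l - 1) (k := -l - m - 1) (by omega) fun i h2 h3 => ?_) ?_
  · rw [layout_counter (by omega) (by omega), loader]
  refine .head (b := (.inr .erase, (-l - m - 1 + 1 : ℤ), layout l m (chunks chunk data m)))
    (Step.right ?_) ?_
  · rw [layout_outside (by omega) (by omega), loader]
  rw [sub_add_cancel]
  refine (h3 m).trans (.head (b := (.inr .find, (-l + 1 : ℤ), layout l 0 (chunks chunk data m)))
    (Step.right ?_) ?_)
  · rw [layout_outside (by omega) (by omega), loader]
  refine Relation.ReflTransGen.trans (Run.rightwards (M := Mach) (fun _ => .inr .find)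
    (i := -l + 1) (k := 0) (by omega) fun i h2 h3 => ?_) ?_
  · rw [layout_outside (by omega) (by omega), loader]
  -- The search stops on cell 0, the leading 1 of the first chunk, which exists because m > 0. The
  -- detour through cell -1 leaves the head on cell 0.
  refine .head (b := (.inr .enter, (0 - 1 : ℤ), layout l 0 (chunks chunk data m))) (Step.left ?_) ?_
  · rw [layout_chunks_of_dvd hl h1 le_rfl (by positivity) (dvd_zero _), loader]
  · exact .single (Step.right rfl)

end Load

end TwoSymbol

namespace TwoSymbol

open Turing StateTransition

/-! ### Busy Beaver machines from transition tables -/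

variable {σ : Type}

/-- One step of a two-symbol machine. -/
def step (M : Table σ) : Option σ × Tape Bool → Option (Option σ × Tape Bool)
  | (none, _) => none
  | (some q, T) => some ((M q T.head).2.2, (T.write (M q T.head).1).move (M q T.head).2.1)

theorem iterate_of_reaches {α : Type} {f : α → Option α} {a b : α} (h : Reaches f a b) :
    ∃ t : ℕ, (fun o => Option.bind o f)^[t] (some a) = some b := by
  induction h with
  | refl => exact ⟨0, rfl⟩
  | tail _ h ih =>
    obtain ⟨t, ht⟩ := ih
    exact ⟨t + 1, by rw [Function.iterate_succ_apply', ht]; exact h⟩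

theorem tape_ext {T T' : Tape Bool} (h : ∀ i, T.nth i = T'.nth i) : T = T' := by
  obtain ⟨a, L, R⟩ := T
  obtain ⟨a', L', R'⟩ := T'
  have h0 : a = a' := h 0
  have hL : L = L' := ListBlank.ext fun i => h (Int.negSucc i)
  have hR : R = R' := ListBlank.ext fun i => h (Int.ofNat (i + 1))
  rw [h0, hL, hR]

/-- A run on functions from the integers is a run on tapes. -/
theorem Run.exists_reaches {M : Table σ} {c c' : σ × ℤ × (ℤ → Bool)} (h : Run M c c')
    {T : Tape Bool} (hT : ∀ i, T.nth i = c.2.2 (c.2.1 + i)) :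
    ∃ T', Reaches (step M) (some c.1, T) (some c'.1, T') ∧
      ∀ i, T'.nth i = c'.2.2 (c'.2.1 + i) := by
  induction h with
  | refl => exact ⟨T, .refl, hT⟩
  | @tail c₁ c₂ _ h ih =>
    obtain ⟨T₁, hr, hT₁⟩ := ih
    obtain ⟨b, d, hM, hp, hf⟩ := h
    have h0 : T₁.head = c₁.2.2 c₁.2.1 := by
      rw [← Tape.nth_zero, hT₁, add_zero]
    refine ⟨(T₁.write b).move d, hr.tail ?_, fun i => ?_⟩
    · rw [Option.mem_def, step, h0, hM]
    · have hw : ∀ j, (T₁.write b).nth j = c₂.2.2 (c₁.2.1 + j) := by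
        intro j
        rw [Tape.write_nth, hf, Function.update_apply, hT₁]
        simp
      rw [hp]
      cases d
      · rw [Tape.move_left_nth, hw]
        exact congrArg c₂.2.2 (by simp only [disp]; ring)
      · rw [Tape.move_right_nth, hw]
        exact congrArg c₂.2.2 (by simp only [disp]; ring)

/-- The halting transition of a table must move the head too; this shifts the tape but keeps the
number of ones. -/
theorem ncard_move_right (T : Tape Bool) :
    {i : ℤ | (T.move .right).nth i = true}.ncard = {i : ℤ | T.nth i = true}.ncard := by
  have : {i : ℤ | T.nth i = true} = (· + 1) '' {i : ℤ | (T.move .right).nth i = true} := by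
    ext i
    simp [Tape.move_right_nth]
  rw [this, Set.ncard_image_of_injective _ (add_left_injective 1)]

/-- A table with `n` states that halts gives a lower bound for the Busy Beaver function. -/
theorem ncard_le_busyBeaver [Finite σ] {n : ℕ} (hn : Nat.card σ = n) (M : Table σ) (s : σ)
    {T : Tape Bool} (h : Reaches (step M) (some s, default) (none, T)) :
    {i : ℤ | T.nth i = true}.ncard ≤ busyBeaver n := by
  have : Nonempty σ := ⟨s⟩
  have h0 : 0 < n := hn ▸ Nat.card_pos
  let e₀ : σ ≃ Fin n := Finite.equivFinOfCardEq hn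
  -- The swap makes s the state number 0, in which Busy Beaver machines start.
  let e : σ ≃ Fin n := e₀.trans (Equiv.swap (e₀ s) ⟨0, h0⟩)
  have he : e s = ⟨0, h0⟩ := by simp [e]
  let B : BeaverMachine n := fun q b =>
    ((M (e.symm q) b).1, (M (e.symm q) b).2.1, (M (e.symm q) b).2.2.map e)
  refine le_csSup (finite_beaverScores n).bddAbove ⟨B, T, ?_, rfl⟩
  have hr : Reaches B.step (some (e s), default) (none, T) := by
    refine Relation.ReflTransGen.lift (fun c : Option σ × Tape Bool => (c.1.map e, c.2)) ?_ _ _ h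
    rintro ⟨_ | q, T⟩ c hc
    · cases hc
    · cases hc
      simp [Function.onFun, BeaverMachine.step, B]
  obtain ⟨t, ht⟩ := iterate_of_reaches hr
  refine ⟨t, ?_⟩
  rw [BeaverMachine.init, dif_pos h0, ← he]
  exact ht

/-! ### Post machines as tables -/

section Post

variable {Λ : Type} [Inhabited Λ] (M : TM0.Machine Bool Λ) (S : Set Λ) (h0 : default ∈ S)

open Classical in
/-- The states outside of `S` are replaced by the initial state. -/
noncomputable def clip (q : Λ) : S := if h : q ∈ S then ⟨q, h⟩ else ⟨default, h0⟩

theorem clip_val {q : Λ} (hq : q ∈ S) : (clip S h0 q : Λ) = q := by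
  rw [clip, dif_pos hq]

/-- A Post machine with states in `S`, as a table. To write a symbol the machine moves right and
comes back. -/
noncomputable def postTable : Table (S ⊕ S)
  | .inl q, a => match M q a with
    | none => (a, .right, none)
    | some (q', .move d) => (a, d, some (.inl (clip S h0 q')))
    | some (q', .write b) => (b, .right, some (.inr (clip S h0 q')))
  | .inr q, a => (a, .left, some (.inl q))

variable {M S}

theorem postTable_reaches (hS : TM0.Supports M S) {c c' : TM0.Cfg Bool Λ}
    (h : Reaches (TM0.step M) c c') (hc : c.q ∈ S) : c'.q ∈ S ∧
      Reaches (step (postTable M S h0)) (some (.inl (clip S h0 c.q)), c.Tape)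
        (some (.inl (clip S h0 c'.q)), c'.Tape) := by
  induction h with
  | refl => exact ⟨hc, .refl⟩
  | @tail c₁ c₂ _ h ih =>
    obtain ⟨hm, hr⟩ := ih
    refine ⟨TM0.step_supports M hS h hm, hr.trans ?_⟩
    obtain ⟨q, T⟩ := c₁
    have hq : (clip S h0 q : Λ) = q := clip_val S h0 hm
    obtain ⟨⟨q', s⟩, h1, rfl⟩ := Option.map_eq_some_iff.1 h
    cases s with
    | move d =>
      refine .single ?_
      simp only [Option.mem_def, step, postTable, hq, h1, Tape.write_self]
    | write b =>
      refine .head (b := (some (.inr (clip S h0 q')), (T.write b).move .right)) ?_ (.single ?_)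
      · simp only [Option.mem_def, step, postTable, hq, h1]
      · simp only [Option.mem_def, step, postTable, Tape.write_self, Tape.move_right_left]

theorem postTable_halts (hS : TM0.Supports M S) {T : Tape Bool} {c : TM0.Cfg Bool Λ}
    (h : c ∈ eval (TM0.step M) ⟨default, T⟩) :
    Reaches (step (postTable M S h0)) (some (.inl (clip S h0 default)), T)
      (none, c.Tape.move .right) := by
  obtain ⟨h1, h2⟩ := mem_eval.1 h
  obtain ⟨h3, h4⟩ := postTable_reaches h0 hS h1 h0
  refine h4.tail ?_
  obtain ⟨q, T'⟩ := c
  have hM : M q T'.head = none := Option.map_eq_none_iff.1 h2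
  simp only [Option.mem_def, step, postTable, clip_val S h0 h3, hM, Tape.write_self]

end Post

/-- A Post machine `M` with finitely many states, working on a tape with `n - C` chunks of data,
can be replaced by a machine with `n` states that is started on the blank tape. -/
theorem exists_ncard_le_busyBeaver {Λ V : Type} [Inhabited Λ] [Finite V] {M : TM0.Machine Bool Λ}
    {S : Set Λ} (hfin : S.Finite) (hS : TM0.Supports M S) {l : ℕ} {chunk : V → List Bool}
    (hc : IsChunk l chunk) : ∃ C : ℕ, ∀ n data c, C < n →
      c ∈ eval (TM0.step M) ⟨default, Tape.mk₁ (chunks chunk data (n - C))⟩ →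
      {i : ℤ | c.Tape.nth i = true}.ncard ≤ busyBeaver n := by
  have : Finite S := hfin
  have : NeZero l := ⟨by have := hc.two_le; omega⟩
  -- There are m + 1 counting states for m data, as the last one detects that loading is complete.
  -- All other states are independent of n.
  refine ⟨Nat.card (Ctl l V (S ⊕ S)) + 1, fun n data c hn h => ?_⟩
  set m := n - (Nat.card (Ctl l V (S ⊕ S)) + 1) with hm
  have hcard : Nat.card (Fin (m + 1) ⊕ Ctl l V (S ⊕ S)) = n := by
    rw [Nat.card_sum, Nat.card_fin]
    omega
  have h1 := run_loader (m := m) (data := data) (R := postTable M S hS.1)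
    (q₀ := .inl (clip S hS.1 default)) hc (by omega)
  obtain ⟨T, hr, hT⟩ := h1.exists_reaches (T := default) (fun i => by
    cases i with
    | ofNat i => cases i <;> rfl
    | negSucc i => rfl)
  replace hT : ∀ i, T.nth i = layout l 0 (chunks chunk data m) (0 + i) := hT
  have hTm : T = Tape.mk₁ (chunks chunk data m) := by
    refine tape_ext fun i => ?_
    rw [hT, zero_add]
    cases i with
    | ofNat i =>
      have : (Tape.mk₁ (chunks chunk data m)).nth (i : ℕ) = _ := Tape.mk'_nth_nat _ _ _
      rw [Int.ofNat_eq_natCast, this, layout_nonneg, ListBlank.nth_mk]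
      rfl
    | negSucc i =>
      rw [layout_outside (by omega) (by omega)]
      rfl
  rw [← ncard_move_right]
  refine ncard_le_busyBeaver hcard _ _ (hr.trans ?_)
  subst hTm
  refine Relation.ReflTransGen.lift
    (fun c : Option (S ⊕ S) × Tape Bool => (c.1.map (Sum.inr ∘ Ctl.run), c.2)) ?_ _ _
    (postTable_halts hS.1 hS h)
  rintro ⟨_ | q, T⟩ c hc
  · cases hc
  · cases hc
    rfl

end TwoSymbol

namespace TwoSymbol

open Turing StateTransition

/-! ### Stack machines -/

/-- An encoding of a finite alphabet by bit vectors in which the blank symbol corresponds to zeros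
and the other symbols begin with `1`. -/
theorem exists_enc (Γ : Type) [Inhabited Γ] [Finite Γ] :
    ∃ (n : ℕ) (enc : Γ → List.Vector Bool (n + 1)) (dec : List.Vector Bool (n + 1) → Γ),
      enc default = List.Vector.replicate (n + 1) false ∧ (∀ a, dec (enc a) = a) ∧
        ∀ a ≠ default, (enc a).toList.headI = true := by
  classical
  obtain ⟨n, enc, dec, -, h⟩ := TM1to1.exists_enc_dec (Γ := Γ)
  refine ⟨n, fun a => if a = default then List.Vector.replicate (n + 1) false else true ::ᵥ enc a,
    fun v => if v.head then dec v.tail else default, by simp, fun a => ?_, fun a ha => ?_⟩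
  · beta_reduce
    by_cases ha : a = default
    · rw [if_pos ha]
      exact ha.symm
    · simp [ha, h]
  · simp [ha]

theorem getI_flatMap {Γ : Type} [Inhabited Γ] {w : ℕ} (hw : 0 < w) {f : Γ → List Bool}
    (hf : ∀ a, (f a).length = w) (h0 : (f default).headI = false) (l : List Γ) (i : ℕ) :
    (l.flatMap f).getI (i * w) = (f (l.getI i)).headI := by
  induction l generalizing i with
  | nil => simp [h0]
  | cons a l ih =>
    rw [List.flatMap_cons]
    cases i with
    | zero =>
      rw [zero_mul, List.getI_append _ _ _ (by rw [hf]; exact hw), List.getI_cons_zero]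
      cases h : f a <;> simp
    | succ i =>
      rw [List.getI_append_right _ _ _ (by rw [hf]; nlinarith), hf, List.getI_cons_succ, ← ih]
      congr 1
      rw [add_mul, one_mul, Nat.add_sub_cancel]

theorem nth_flatMap {Γ : Type} [Inhabited Γ] {w : ℕ} (hw : 0 < w) {f : Γ → List Bool}
    (hf : ∀ a, (f a).length = w) (h0 : (f default).headI = false)
    (hd : ∃ n, f default = List.replicate n default) (L : ListBlank Γ) (i : ℕ) :
    (L.flatMap f hd).nth (i * w) = (f (L.nth i)).headI := by
  refine L.induction_on fun l => ?_
  rw [ListBlank.flatMap_mk, ListBlank.nth_mk, ListBlank.nth_mk, getI_flatMap hw hf h0]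

theorem finite_nth_listBlank (L : ListBlank Bool) : {i : ℕ | L.nth i = true}.Finite := by
  refine L.induction_on fun l => (Set.finite_lt_nat l.length).subset fun i hi => ?_
  by_contra h
  rw [Set.mem_ofPred_eq, ListBlank.nth_mk, List.getI_eq_default _ (not_lt.1 h)] at hi
  cases hi

theorem finite_nth_tape (T : Tape Bool) : {i : ℤ | T.nth i = true}.Finite := by
  refine (((finite_nth_listBlank T.left).image Int.negSucc).union
    ((finite_nth_listBlank T.right₀).image Int.ofNat)).subset fun i hi => ?_
  cases i with
  | ofNat i => exact Or.inr ⟨i, (T.right₀_nth i).trans hi, rfl⟩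
  | negSucc i => exact Or.inl ⟨i, hi, rfl⟩

theorem flatMap_range_two_mul {α : Type} (g : ℕ → List α) (m : ℕ) :
    (List.range (2 * m)).flatMap g = (List.range m).flatMap fun j => g (2 * j) ++ g (2 * j + 1) := by
  induction m with
  | zero => simp
  | succ m ih =>
    rw [show 2 * (m + 1) = 2 * m + 1 + 1 by ring]
    simp [List.range_succ, List.flatMap_append, ih]

section Stack

variable {K : Type} [DecidableEq K] {Γ : K → Type}

/-- The tape symbol that represents a symbol of the stack `k`. -/
def cellOf (k : K) (b : Bool) (a : Γ k) : TM2to1.Γ' K Γ :=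
  (b, Function.update (fun _ => none) k (some a))

theorem trInit_eq (k : K) [Inhabited (Γ k)] {s : List (Γ k)} (hs : s ≠ []) :
    TM2to1.trInit k s =
      (List.range s.length).map fun i => cellOf k (decide (i = 0)) (s.reverse.getI i) := by
  have hs' : s.reverse ≠ [] := by simpa using hs
  rw [← List.length_reverse, TM2to1.trInit]
  generalize s.reverse = r at hs'
  obtain ⟨a, r, rfl⟩ := List.exists_cons_of_ne_nil hs'
  rw [List.length_cons, List.range_succ_eq_map]
  have h : r.map (cellOf k false) = ((List.range r.length).map Nat.succ).map
      fun i => cellOf k (decide (i = 0)) ((a :: r).getI i) := by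
    refine List.ext_getElem (by simp) fun i h1 h2 => ?_
    rw [List.length_map] at h1
    simp [List.getI_eq_getElem _ h1]
  exact congrArg₂ List.cons rfl h

theorem cellOf_ne_default (k : K) (b : Bool) (a : Γ k) : cellOf k b a ≠ default := fun h => by
  have := congrFun (congrArg Prod.snd h) k
  simp [cellOf] at this

/-- The height of a stack of a stack machine that halts, started with `2 * (n - C)` symbols on that
stack, is a lower bound for the Busy Beaver function. -/
theorem exists_length_le_busyBeaver [Fintype K] [∀ k, Fintype (Γ k)] {Λ σ : Type} [Inhabited Λ]
    [Inhabited σ] [Fintype σ] (M : Λ → TM2.Stmt Γ Λ σ) {S : Finset Λ}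
    (hS : TM2.Supports M S) (k : K) [Inhabited (Γ k)] : ∃ C : ℕ, ∀ n s c, C < n →
      s.length = 2 * (n - C) → c ∈ eval (TM2.step M) (TM2.init k s) →
      (c.stk k).length ≤ busyBeaver n := by
  obtain ⟨w, enc, dec, enc0, encdec, henc⟩ := exists_enc (TM2to1.Γ' K Γ)
  let M₁ := TM2to1.tr M
  let M₂ := TM1to1.tr enc dec M₁
  let M₃ := TM1to0.tr M₂
  have hS₃ := TM1to0.tr_supports M₂ (TM1to1.tr_supports enc dec M₁ (TM2to1.tr_supports M hS))
  -- Two stack symbols go into each chunk, hence into each state; this factor 2 is what makes room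
  -- for programs longer than n. The Boolean marks the bottom of the stack and is set for the first
  -- chunk only.
  let chunk : Bool × Γ k × Γ k → List Bool := fun v =>
    (enc (cellOf k v.1 v.2.1)).toList ++ (enc (cellOf k false v.2.2)).toList
  have hc : IsChunk (w + 1 + (w + 1)) chunk := by
    refine ⟨fun v => by simp [chunk], fun v => ?_, by omega⟩
    have h1 := henc _ (cellOf_ne_default k v.1 v.2.1)
    simp only [chunk]
    cases h : (enc (cellOf k v.1 v.2.1)).toList with
    | nil => simpa using congrArg List.length h
    | cons a l =>
      rw [h] at h1
      simpa using h1
  obtain ⟨C, hC⟩ := exists_ncard_le_busyBeaver (Finset.finite_toSet _) hS₃ hc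
  refine ⟨C, fun n s c hn hs h => ?_⟩
  let data : ℕ → Bool × Γ k × Γ k := fun j =>
    (decide (j = 0), s.reverse.getI (2 * j), s.reverse.getI (2 * j + 1))
  have hs0 : s ≠ [] := by
    rintro rfl
    simp at hs
    omega
  obtain ⟨c₁, hr₁, h₁⟩ := tr_eval (TM2to1.tr_respects M) (TM2to1.trCfg_init k s) h
  obtain ⟨c₂, hr₂, h₂⟩ := tr_eval (TM1to1.tr_respects (enc0 := enc0) dec M₁ encdec) rfl h₁
  obtain ⟨c₃, hr₃, h₃⟩ := tr_eval (TM1to0.tr_respects M₂) rfl h₂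
  have hinit : TM1to0.trCfg M₂ (TM1to1.trCfg enc enc0 (TM1.init (TM2to1.trInit k s))) =
      ⟨default, Tape.mk₁ (chunks chunk data (n - C))⟩ := by
    have : TM1to1.trTape enc0 (Tape.mk₁ (TM2to1.trInit k s)) =
        Tape.mk₁ (chunks chunk data (n - C)) := by
      rw [Tape.mk₁, Tape.mk₂, TM1to1.trTape_mk', TM1to1.trTape', ListBlank.flatMap_mk,
        ListBlank.flatMap_mk, trInit_eq k hs0, hs, List.flatMap_map, flatMap_range_two_mul]
      refine congrArg₂ Tape.mk' rfl (congrArg ListBlank.mk ?_)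
      refine List.flatMap_congr fun j _ => ?_
      simp [chunk, data]
    exact congrArg (TM0.Cfg.mk _) this
  rw [hinit] at h₃
  refine le_trans ?_ (hC n data c₃ hn h₃)
  obtain ⟨L, hL⟩ := hr₁
  rename_i q v S
  subst hr₂ hr₃
  -- Each level of the stack occupies a nonblank cell, whose code begins with 1. So the ones at
  -- multiples of w + 1 already number at least the height of the stack.
  have hnth : ∀ i < (S k).length,
      (TM1to1.trTape enc0 (Tape.mk' ∅ (TM2to1.addBottom L))).nth ((i * (w + 1) : ℕ) : ℤ) = true := by
    intro i hi
    rw [TM1to1.trTape_mk', TM1to1.trTape', Tape.mk'_nth_nat, nth_flatMap (Nat.succ_pos w)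
      (by simp) (by rw [enc0]; rfl)]
    refine henc _ fun hd => ?_
    have h1 := TM2to1.addBottom_nth_snd L i
    rw [hd] at h1
    have h2 := TM2to1.stk_nth_val i (hL k)
    rw [← h1, List.getElem?_eq_getElem (by simpa using hi)] at h2
    cases h2
  have hinj : Function.Injective fun i : ℕ => ((i * (w + 1) : ℕ) : ℤ) := fun i j hij => by
    have : i * (w + 1) = j * (w + 1) := Nat.cast_injective (R := ℤ) hij
    exact Nat.eq_of_mul_eq_mul_right (Nat.succ_pos w) this
  calc (S k).length = (Set.Iio (S k).length).ncard := by
        rw [Set.ncard_eq_toFinset_card']; simp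
    _ = ((fun i : ℕ => ((i * (w + 1) : ℕ) : ℤ)) '' Set.Iio (S k).length).ncard :=
        (Set.ncard_image_of_injective _ hinj).symm
    _ ≤ _ := Set.ncard_le_ncard (by rintro _ ⟨i, hi, rfl⟩; exact hnth i hi) (finite_nth_tape _)

end Stack

end TwoSymbol

/-! ### Upper bound by the Busy Beaver function -/

namespace StackMachine

open Turing Turing.PartrecToTM2 StateTransition

/-- The length of the output of a code is a lower bound for the Busy Beaver function. -/
theorem exists_length_trNat_le_busyBeaver (c : ToPartrec.Code) : ∃ C : ℕ, ∀ n N out, C < n →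
    (trNat N).length + 1 = 2 * (n - C) → c.eval [N] = pure [out] →
    (trNat out).length ≤ busyBeaver n := by
  have : Fintype K' := Fintype.ofFinite K'
  let : Inhabited Λ' := ⟨trNormal c Cont'.halt⟩
  have hS : TM2.Supports prog (codeSupp c Cont'.halt) := tr_supports c Cont'.halt
  obtain ⟨C, hC⟩ := TwoSymbol.exists_length_le_busyBeaver prog hS K'.main
  refine ⟨C, fun n N out hn hN hc => ?_⟩
  have hinit : init c [N] = TM2.init (Γ := fun _ : K' => Γ') K'.main (trList [N]) := by
    refine congrArg (TM2.Cfg.mk _ _) (funext fun k => ?_)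
    cases k <;> rfl
  have h1 := PartrecToTM2.tr_eval c [N]
  rw [hc] at h1
  have h2 : halt [out] ∈ eval (TM2.step prog) (init c [N]) := by
    refine (congrArg (halt [out] ∈ ·) h1).mpr ?_
    exact Part.mem_map _ (Part.mem_some _)
  rw [hinit] at h2
  have h3 := hC n (trList [N]) (halt [out]) hn (by simpa using hN) h2
  refine le_trans ?_ h3
  have : (halt [out]).stk K'.main = trList [out] := rfl
  rw [this]
  simp

theorem length_trNat_num (w : List Bool) : (trNat (num w)).length = w.length + 1 := by
  induction w using List.reverseRecOn with
  | nil => rfl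
  | append_singleton w b ih => rw [num_concat, trNat_bit (num_pos w)]; simp [ih]

theorem length_trNat_two_pow (k : ℕ) : (trNat (2 ^ k)).length = k + 1 := by
  induction k with
  | zero => rfl
  | succ k ih => rw [pow_succ', trNat_two_mul (by positivity)]; simp [ih]

end StackMachine

namespace PrefixTM

open StackMachine

/-- Drop the ones at the beginning and the zero that follows. -/
def unpad (w : List Bool) : List Bool := (w.dropWhile id).tail

theorem primrec_unpad : Primrec unpad :=
  Primrec.list_tail.comp (Primrec.list_dropWhile .id)

theorem unpad_replicate (i : ℕ) (p : List Bool) :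
    unpad (List.replicate i true ++ false :: p) = p := by
  induction i with
  | zero => simp [unpad]
  | succ i ih => simpa only [unpad, List.replicate_succ, List.cons_append, List.dropWhile_cons, id, if_true] using ih

/-- The halting time of a program is small compared with the Busy Beaver function for any number of
states that allows for storing the program with two bits per state. -/
theorem exists_time_mul_le_busyBeaver (U : PrefixTM) : ∃ C : ℕ, ∀ n p x, C < n →
    p.length + 3 ≤ 2 * (n - C) → U.Outputs p [] x →
    ∃ t, U.OutputsWithin t p [] x ∧ t * (n - C) ≤ busyBeaver n := by
  set S := Sim.simulator U
  obtain ⟨c, hc⟩ := exists_code_of_partrec (f := fun N =>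
      (Nat.rfind fun t => Part.some (S.exact (unpad (unnum N)) t).isSome).map fun t =>
        2 ^ (t * (unnum N).length)) (by
    refine Partrec.map (Partrec.rfind (p := fun N t =>
      Part.some (S.exact (unpad (unnum N)) t).isSome) ?_) ?_
    · have h : Primrec fun a : ℕ × ℕ => (S.exact (unpad (unnum a.1)) a.2).isSome :=
        Primrec.option_isSome.comp (S.primrec_exact.comp
          (primrec_unpad.comp (primrec_unnum.comp .fst)) .snd)
      exact h.to_comp
    · have h : Primrec fun a : ℕ × ℕ => 2 ^ (a.2 * (unnum a.1).length) :=
        primrec_two_pow.comp (Primrec.nat_mul.comp .snd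
          (Primrec.list_length.comp (primrec_unnum.comp .fst)))
      exact h.to_comp)
  obtain ⟨C, hC⟩ := exists_length_trNat_le_busyBeaver c
  refine ⟨C, fun n p x hn hp ⟨d, hd⟩ => ?_⟩
  -- The stack must have exactly 2(n - C) symbols. The numeral of w has |w| + 1 digits and the
  -- separator adds one, so p is padded to |w| = 2(n - C) - 2.
  set w := List.replicate (2 * (n - C) - 3 - p.length) true ++ false :: p with hw
  have hlen : w.length + 2 = 2 * (n - C) := by
    simp [hw]
    omega
  have hun : unpad (unnum (num w)) = p := by rw [unnum_num, hw, unpad_replicate]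
  have hdx := S.exact_eq_some.2 hd
  have hdom : (Nat.rfind fun t => Part.some (S.exact (unpad (unnum (num w))) t).isSome).Dom :=
    Nat.rfind_dom'.2 ⟨d, by rw [hun, hdx]; simp, fun _ => trivial⟩
  obtain ⟨t, ht⟩ := Part.dom_iff_mem.1 hdom
  have h1 := Nat.rfind_spec ht
  have h2 : (S.exact p t).isSome = true := by
    rw [hun] at h1
    exact (Part.mem_some_iff.1 h1).symm
  obtain ⟨y, hy⟩ := Option.isSome_iff_exists.1 h2
  have hyx : y = x := Option.some_inj.1 <|
    (S.exact_mono (le_max_left t d) hy).symm.trans (S.exact_mono (le_max_right t d) hdx)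
  subst hyx
  refine ⟨t, S.exact_eq_some.1 hy, ?_⟩
  have h3 := hC n (num w) (2 ^ (t * w.length)) hn (by rw [length_trNat_num]; omega) (by
    rw [hc, Part.eq_some_iff.2 ht, unnum_num]
    simp)
  rw [length_trNat_two_pow] at h3
  -- Since |p| + 3 ≤ 2(n - C), we have n - C ≥ 2 and hence |w| ≥ n - C. The exponent t|w| in the
  -- output makes the numeral longer than the halting time by this factor.
  have h4 : t * (n - C) ≤ t * w.length := Nat.mul_le_mul_left _ (by omega)
  omega

/-- Admissibility provides a shortest program that competes in the definition of the depth. Its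
length is at most n + n/16 + c, which for large n fits into the capacity of about 2(n - C) bits. -/
theorem IsOptimalUniversal.eventually_maxDepthDrop_mul_le {U : PrefixTM}
    (hU : U.IsOptimalUniversal) :
    ∃ C : ℕ, ∀ᶠ n in atTop, U.maxDepthDrop n * (n - C) ≤ busyBeaver n := by
  obtain ⟨c, hc⟩ := hU.exists_program_self
  obtain ⟨C, hC⟩ := U.exists_time_mul_le_busyBeaver
  refine ⟨C, ?_⟩
  filter_upwards [eventually_ge_atTop (10 * (C + c + 1))] with n hn
  have hle : ∀ k ∈ U.depthDrops n, k * (n - C) ≤ busyBeaver n := by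
    rintro k ⟨x, b, hx, -, ⟨p, ⟨hp, hpl⟩, hpi⟩, rfl⟩
    obtain ⟨q, hq, hqx⟩ := hc x
    have hK := K_le hqx
    rw [hx] at hq
    obtain ⟨t, ht, htn⟩ := hC n p x (by omega) (by omega) hp
    have hd : U.logicalDepth b x ≤ t := Nat.sInf_le ⟨p, ht, hpi⟩
    exact (Nat.mul_le_mul_right _ ((Nat.sub_le _ _).trans hd)).trans htn
  -- Without admissible pairs the supremum is 0, in accordance with the convention for f.
  rcases (U.depthDrops n).eq_empty_or_nonempty with h | h
  · simp [maxDepthDrop, h]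
  · exact hle _ (Nat.sSup_mem h (finite_depthDrops U n).bddAbove)

/-- The maximal drop in logical depth is small compared with the Busy Beaver function. -/
theorem IsOptimalUniversal.maxDepthDrop_isLittleO {U : PrefixTM} (hU : U.IsOptimalUniversal) :
    (fun n => (U.maxDepthDrop n : ℝ)) =o[atTop] (fun n => (busyBeaver n : ℝ)) := by
  obtain ⟨C, hC⟩ := hU.eventually_maxDepthDrop_mul_le
  rw [isLittleO_iff]
  intro ε hε
  obtain ⟨k, hk⟩ := exists_nat_gt (1 / ε)
  filter_upwards [hC, eventually_ge_atTop (C + k)] with n h hn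
  have hk' : 1 ≤ ε * k := by
    rw [div_lt_iff₀ hε] at hk
    linarith
  have h1 : (U.maxDepthDrop n : ℝ) * k ≤ busyBeaver n := by
    exact_mod_cast (Nat.mul_le_mul_left _ (by omega)).trans h
  rw [Real.norm_natCast, Real.norm_natCast]
  calc (U.maxDepthDrop n : ℝ) ≤ U.maxDepthDrop n * (ε * k) :=
        le_mul_of_one_le_right (Nat.cast_nonneg _) hk'
    _ = ε * (U.maxDepthDrop n * k) := by ring
    _ ≤ ε * busyBeaver n := mul_le_mul_of_nonneg_left h1 hε.le

end PrefixTM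

theorem mainTheorem3 (U : PrefixTM) (hU : U.IsOptimalUniversal) :
    (∃ c : ℕ, ∀ b ≥ c, ∀ x : List Bool, U.Admissible b x) ∧
    (∀ g : ℕ → ℕ, Computable g → ∀ᶠ n in atTop, g n < U.maxDepthDrop n) ∧
    (fun n => (U.maxDepthDrop n : ℝ)) =o[atTop] (fun n => (busyBeaver n : ℝ)) :=
  ⟨hU.exists_forall_admissible, fun _ hg => hU.eventually_lt_maxDepthDrop hg,
    hU.maxDepthDrop_isLittleO⟩
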